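/- Let $\mathbb F$ be a finite field and let $l\ge 2$ be an integer. For $N\in\mathbb N$ let $V_N=\bigoplus_{a=1}^{l}G_a$ with $G_a=\mathbb F^{2N}$ ($l$ parties holding $N$ qudits each), so that $V_N=\mathbb F^{2Nl}$, equipped with the standard symplectic form, the orthogonal sum of the standard symplectic forms of the $G_a$. Let $\mathcal L(N)$ be the finite set of Lagrangian subspaces $L\subset V_N$ ($L=L^\perp$), with the uniform probability measure $P$. For a set $S$ of parties let $L_S$ be the space of those $v\in L$ whose components at all parties outside $S$ vanish. Put $C^jL=\bigoplus_{|S|=j}L_S$, and let $\delta_j\colon C^jL\to C^{j+1}L$ be given by $(\delta_j c)_T=\sum_{b\in T}(-1)^{|\{a\in T:\,a<b\}|}\,c_{T\setminus\{b\}}$. Then $\delta_{j+1}\delta_{j}=0$; let $H^jL=\ker\delta_j/\operatorname{im}\delta_{j-1}$ (with $\operatorname{im}\delta_{-1}=0$). For a random $L\in\mathcal L(N)$ the following hold. 1. If $j<l/2$ then $\lim_{N\to\infty}P(C^jL\ne0)=0$. 2. If $j<l/2$, or $j>l/2+2$, or $l$ is even and $j>l/2+1$, then $\lim_{N\to\infty}P(H^jL\neq0)=0$.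 Assume now that $l$ is even, and let $\chi=2\binom{l-2}{l/2-1}$. Then for every $\epsilon>0$: 3. $\lim_{N\to\infty}P\bigl(\tfrac1N\dim C^{l/2}L\ge\epsilon\bigr)=0$; 4. $\lim_{N\to\infty}P\bigl(\tfrac1N\dim H^{l/2}L+\tfrac1N\dim H^{l/2+2}L\ge\epsilon\bigr)=0$; 5. $\lim_{N\to\infty}P\bigl(\tfrac1N\dim H^jL\ge\epsilon\bigr)=0$ for every $j\ne l/2+1$, and $\lim_{N\to\infty}P\bigl(\bigl|\tfrac1N\dim H^{l/2+1}L-\chi\bigr|\ge\epsilon\bigr)=0$. Moreover $\chi$ is the limit, as $N\to\infty$, of the absolute value of the expectation of the normalised Euler number $\tfrac1N\sum_j(-1)^j\dim H^jL$. -/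

import Mathlib

open Filter Topology

namespace StabHom

/-- The phase space `F^{2Nl}` of `l` parties holding `N` qudits each.  The party `a` holds the
summand `Fin N → F × F`, of dimension `2N`. -/
abbrev Phase (F : Type*) (l N : ℕ) : Type _ := Fin l → Fin N → F × F

section Field

variable (F : Type*) [Field F] (l N : ℕ)

/-- The standard symplectic form on `F^{2Nl}`:
`ω(v, w) = ∑ (x y' - y x')`, the sum being over all parties and all qudits. -/
def omega : LinearMap.BilinForm F (Phase F l N) :=
  LinearMap.mk₂ F
    (fun v w => ∑ a, ∑ n, ((v a n).1 * (w a n).2 - (v a n).2 * (w a n).1))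
    (fun v v' w => by
      simp only [← Finset.sum_add_distrib]
      refine Finset.sum_congr rfl fun a _ => Finset.sum_congr rfl fun n _ => ?_
      simp only [Pi.add_apply, Prod.fst_add, Prod.snd_add]; ring)
    (fun c v w => by
      simp only [smul_eq_mul, Finset.mul_sum]
      refine Finset.sum_congr rfl fun a _ => Finset.sum_congr rfl fun n _ => ?_
      simp only [Pi.smul_apply, Prod.smul_fst, Prod.smul_snd, smul_eq_mul]; ring)
    (fun v w w' => by
      simp only [← Finset.sum_add_distrib]
      refine Finset.sum_congr rfl fun a _ => Finset.sum_congr rfl fun n _ => ?_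
      simp only [Pi.add_apply, Prod.fst_add, Prod.snd_add]; ring)
    (fun c v w => by
      simp only [smul_eq_mul, Finset.mul_sum]
      refine Finset.sum_congr rfl fun a _ => Finset.sum_congr rfl fun n _ => ?_
      simp only [Pi.smul_apply, Prod.smul_fst, Prod.smul_snd, smul_eq_mul]; ring)

/-- The Lagrange Grassmannian: all subspaces of `F^{2Nl}` that are equal to their own orthogonal
complement with respect to the symplectic form. -/
def LGr : Type _ := {L : Submodule F (Phase F l N) // (omega F l N).orthogonal L = L}

end Field

section Complex

variable {F : Type*} [Field F] {l N : ℕ}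

/-- The vectors of `L` that are local to the set `S` of parties: all components at parties
outside `S` vanish. -/
def localPart (L : Submodule F (Phase F l N)) (S : Finset (Fin l)) :
    Submodule F (Phase F l N) where
  carrier := {v | v ∈ L ∧ ∀ a, a ∉ S → v a = 0}
  add_mem' := fun hv hw =>
    ⟨L.add_mem hv.1 hw.1, fun a ha => by simp [hv.2 a ha, hw.2 a ha]⟩
  zero_mem' := ⟨L.zero_mem, fun _ _ => rfl⟩
  smul_mem' := fun c _ hv => ⟨L.smul_mem c hv.1, fun a ha => by simp [hv.2 a ha]⟩

/-- The chain group `C^j L`, the direct sum of the spaces `localPart L S` over all sets `S` of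
exactly `j` parties.  An element is written as a function of all sets of parties whose value at
`S` lies in `localPart L S` and is zero unless `S` has `j` elements. -/
def chains (L : Submodule F (Phase F l N)) (j : ℕ) :
    Submodule F (Finset (Fin l) → Phase F l N) where
  carrier := {c | ∀ S, c S ∈ localPart L S ∧ (S.card ≠ j → c S = 0)}
  add_mem' := fun hc hd S =>
    ⟨(localPart L S).add_mem (hc S).1 (hd S).1,
      fun h => by simp [(hc S).2 h, (hd S).2 h]⟩
  zero_mem' := fun S => ⟨(localPart L S).zero_mem, fun _ => rfl⟩
  smul_mem' := fun r _ hc S =>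
    ⟨(localPart L S).smul_mem r (hc S).1, fun h => by simp [(hc S).2 h]⟩

/-- The sign of the party `b` in the set `T` of parties: `(-1)` to the number of elements of `T`
that precede `b`. -/
def sgn (F : Type*) [Field F] {l : ℕ} (T : Finset (Fin l)) (b : Fin l) : F :=
  (-1) ^ (T.filter (· < b)).card

/-- The differential: the component of `δ c` at `T` is the alternating sum over `b ∈ T` of the
components of `c` at `T \ {b}`. -/
def delta (F : Type*) [Field F] (l N : ℕ) :
    (Finset (Fin l) → Phase F l N) →ₗ[F] (Finset (Fin l) → Phase F l N) where
  toFun c T := ∑ b ∈ T, sgn F T b • c (T.erase b)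
  map_add' c d := by
    funext T; simp only [Pi.add_apply, smul_add, Finset.sum_add_distrib]
  map_smul' r c := by
    funext T; simp only [Pi.smul_apply, RingHom.id_apply, Finset.smul_sum, smul_comm r]

/-- The `j`-cocycles: the kernel of `δ` on `C^j L`. -/
def cocycles (L : Submodule F (Phase F l N)) (j : ℕ) :
    Submodule F (Finset (Fin l) → Phase F l N) :=
  chains L j ⊓ LinearMap.ker (delta F l N)

/-- The `j`-coboundaries: the image of `C^{j-1} L` under `δ`, which is zero for `j = 0`. -/
def coboundaries (L : Submodule F (Phase F l N)) :
    ℕ → Submodule F (Finset (Fin l) → Phase F l N)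
  | 0 => ⊥
  | j + 1 => (chains L j).map (delta F l N)

theorem localPart_mono (L : Submodule F (Phase F l N)) {S T : Finset (Fin l)} (h : S ⊆ T) :
    localPart L S ≤ localPart L T :=
  fun _ hv => ⟨hv.1, fun a ha => hv.2 a fun h' => ha (h h')⟩

/-- The differential maps `C^j L` into `C^{j+1} L`. -/
theorem delta_mem (L : Submodule F (Phase F l N)) {j : ℕ}
    {c : Finset (Fin l) → Phase F l N} (hc : c ∈ chains L j) :
    delta F l N c ∈ chains L (j + 1) := by
  intro T
  refine ⟨Submodule.sum_mem _ fun b _ => Submodule.smul_mem _ _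
    (localPart_mono L (T.erase_subset b) (hc _).1), fun h => ?_⟩
  refine Finset.sum_eq_zero fun b hb => ?_
  rw [(hc (T.erase b)).2, smul_zero]
  have := Finset.card_erase_add_one hb
  omega

theorem sgn_swap {T : Finset (Fin l)} {a b : Fin l} (ha : a ∈ T) (hab : a < b) :
    sgn F T a * sgn F (T.erase a) b = -(sgn F T b * sgn F (T.erase b) a) := by
  have h1 : (T.erase b).filter (· < a) = T.filter (· < a) := by
    ext x
    simp only [Finset.mem_filter, Finset.mem_erase]
    constructor
    · rintro ⟨⟨_, h⟩, h'⟩; exact ⟨h, h'⟩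
    · rintro ⟨h, h'⟩; exact ⟨⟨(h'.trans hab).ne, h⟩, h'⟩
  have h2 : (T.erase a).filter (· < b) = (T.filter (· < b)).erase a := by
    ext x
    simp only [Finset.mem_filter, Finset.mem_erase, and_assoc]
  have h3 : a ∈ T.filter (· < b) := by simp [ha, hab]
  have h4 := Finset.card_erase_add_one h3
  simp only [sgn, h1, h2, ← h4, pow_succ]
  ring

/-- `δ ∘ δ = 0`. -/
theorem delta_delta (c : Finset (Fin l) → Phase F l N) :
    delta F l N (delta F l N c) = 0 := by
  funext T
  change ∑ b ∈ T, sgn F T b • ∑ a ∈ T.erase b, sgn F (T.erase b) a • c ((T.erase b).erase a) = 0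
  simp only [Finset.smul_sum, smul_smul]
  rw [Finset.sum_sigma']
  refine Finset.sum_involution (fun p _ => ⟨p.2, p.1⟩) ?_ ?_ ?_ ?_
  · rintro ⟨b, a⟩ hp
    simp only [Finset.mem_sigma, Finset.mem_erase] at hp
    obtain ⟨hb, hab, ha⟩ := hp
    dsimp only
    rw [Finset.erase_right_comm (a := a) (b := b), ← add_smul]
    rcases lt_or_gt_of_ne hab with h | h
    · rw [sgn_swap ha h, add_neg_cancel, zero_smul]
    · rw [sgn_swap hb h, neg_add_cancel, zero_smul]
  · rintro ⟨b, a⟩ hp _ h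
    simp only [Finset.mem_sigma, Finset.mem_erase] at hp
    exact hp.2.1 (congrArg Sigma.fst h)
  · rintro ⟨b, a⟩ hp
    simp only [Finset.mem_sigma, Finset.mem_erase] at hp ⊢
    exact ⟨hp.2.2, hp.2.1.symm, hp.1⟩
  · rintro ⟨b, a⟩ _
    rfl

/-- Coboundaries are cocycles. -/
theorem coboundaries_le_cocycles (L : Submodule F (Phase F l N)) (j : ℕ) :
    coboundaries L j ≤ cocycles L j := by
  cases j with
  | zero => exact bot_le
  | succ j =>
    rintro _ ⟨c, hc, rfl⟩
    exact ⟨delta_mem L hc, delta_delta c⟩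

/-- The group `H^j L`, cocycles modulo coboundaries. -/
abbrev Homology (L : Submodule F (Phase F l N)) (j : ℕ) : Type _ :=
  cocycles L j ⧸ (coboundaries L j).submoduleOf (cocycles L j)

/-- The normalised dimension `(1/N) dim C^j L`. -/
noncomputable def normDimC (L : LGr F l N) (j : ℕ) : ℝ :=
  (Module.finrank F (chains L.1 j) : ℝ) / N

/-- The normalised dimension `(1/N) dim H^j L`. -/
noncomputable def normDimH (L : LGr F l N) (j : ℕ) : ℝ :=
  (Module.finrank F (Homology L.1 j) : ℝ) / N

/-- The normalised Euler number `(1/N) ∑_j (-1)^j dim H^j L`; all groups of degree greater than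
`l` vanish. -/
noncomputable def normEuler (L : LGr F l N) : ℝ :=
  ∑ j ∈ Finset.range (l + 1), (-1) ^ j * normDimH L j

end Complex

section Probability

variable {F : Type*} [Field F] [Finite F] {l N : ℕ}

instance : Finite (LGr F l N) :=
  inferInstanceAs (Finite {L : Submodule F (Phase F l N) // (omega F l N).orthogonal L = L})

/-- The Laplace (uniform) probability of the event `E` for a random Lagrangian. -/
noncomputable def prob (E : LGr F l N → Prop) : ℝ :=
  (Nat.card {L : LGr F l N // E L} : ℝ) / Nat.card (LGr F l N)

/-- The expectation of `X` for a uniformly random Lagrangian. -/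
noncomputable def expect (X : LGr F l N → ℝ) : ℝ :=
  (∑ᶠ L, X L) / Nat.card (LGr F l N)

end Probability

end StabHom

/-! The argument is a first-moment computation combined with a duality and an Euler characteristic.
Write `q = |F|`. A fixed subspace of dimension `r` lies in a random Lagrangian with probability at
most `q^(r(r-1) - Nlr)` (`prob_ge_le`, from exact counting). Summing over the nonzero vectors
supported on `S` bounds the expected dimension of `L_S` by `q^(N(2|S| - l))`: exponentially small
for `|S| < l/2`, at most 1 for `|S| = l/2`. Statements 1 and 3 follow.

For `l = 2m` the chains of degree `m` may survive, but nonzero cocycles almost surely do not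
(`prob_cocycles_le`). Write a cocycle as a coefficient family `z` in a basis of the span of its
values, of dimension `r ≤ 2^l`. The number of possible `z` does not depend on `N`, and each admits
at most `q^(Nlr - N)` bases; the gain `q^N` is the strict inequality `mul_finrank_lt_sum_finrank`.
By duality, absence of cocycles in degree `k` kills the homology in degree `l + 2 - k`
(`subsingleton_homology_of_dual`). So for even `l` every `H^j` with `j ≠ l/2 + 1` vanishes
asymptotically almost surely, which is more than statements 4 and 5 ask of these degrees.

The remaining degree is read off from the Euler number, an alternating sum of the `dim L_S`.
Symplectic duality gives `dim L_S = N(2|S| - l) + dim L_{Sᶜ}`, so for even `l` the Euler number is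
`±Nχ` (`sum_generic_dim`) up to an error of bounded expectation, and Markov's inequality finishes.
-/

namespace StabHom

/-! ### Counting Lagrangian subspaces that contain a given subspace. -/

section Counting

variable {F V : Type*} [Field F] [AddCommGroup V] [Module F V]
  {B : LinearMap.BilinForm F V} {n : ℕ}

theorem sup_span_singleton_isotropic (hB : B.IsAlt) {W : Submodule F V} (hW : W ≤ B.orthogonal W)
    {v : V} (hv : v ∈ B.orthogonal W) :
    W ⊔ Submodule.span F {v} ≤ B.orthogonal (W ⊔ Submodule.span F {v}) := by
  intro x hx y hy
  rw [Submodule.mem_sup] at hx hy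
  obtain ⟨x, hx, a, ha, rfl⟩ := hx
  obtain ⟨y, hy, b, hb, rfl⟩ := hy
  obtain ⟨a, rfl⟩ := Submodule.mem_span_singleton.1 ha
  obtain ⟨b, rfl⟩ := Submodule.mem_span_singleton.1 hb
  have h1 : B y x = 0 := hW hx y hy
  have h2 : B y v = 0 := hv y hy
  have h3 : B v x = 0 := (LinearMap.BilinForm.IsAlt.eq_iff hB).1 (hv x hx)
  have h4 : B v v = 0 := hB v
  simp [h1, h2, h3, h4]

variable [FiniteDimensional F V]

theorem finrank_sup_span_singleton {W : Submodule F V} {v : V} (hv : v ∉ W) :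
    Module.finrank F ↥(W ⊔ Submodule.span F {v}) = Module.finrank F W + 1 := by
  have hd : W ⊓ Submodule.span F {v} = ⊥ := by
    rw [eq_bot_iff]
    rintro x ⟨hx, hx'⟩
    obtain ⟨a, rfl⟩ := Submodule.mem_span_singleton.1 hx'
    by_cases ha : a = 0
    · simp [ha]
    · exact absurd ((W.smul_mem_iff ha).1 hx) hv
  have h := Submodule.finrank_sup_add_finrank_inf_eq W (Submodule.span F {v})
  have hv0 : v ≠ 0 := fun h => hv (by rw [h]; exact W.zero_mem)
  rw [hd, finrank_bot, add_zero, finrank_span_singleton hv0] at h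
  exact h

theorem finrank_of_orthogonal_eq (hn : B.Nondegenerate) (hV : Module.finrank F V = 2 * n)
    {L : Submodule F V} (hL : B.orthogonal L = L) : Module.finrank F L = n := by
  have h := LinearMap.BilinForm.finrank_orthogonal hn L
  have h2 := Submodule.finrank_le L
  rw [hL, hV] at h
  omega

variable [Finite F]

theorem card_diff_submodule {W U : Submodule F V} (h : W ≤ U) :
    (Nat.card {v : V // v ∈ U ∧ v ∉ W} : ℤ) =
      (Nat.card F : ℤ) ^ Module.finrank F U - (Nat.card F : ℤ) ^ Module.finrank F W := by
  have : Finite V := Module.finite_of_finite F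
  have h1 := Set.ncard_sdiff_add_ncard_of_subset (s := (W : Set V)) (t := (U : Set V)) h
    (Set.toFinite _)
  have h2 : Nat.card {v : V // v ∈ U ∧ v ∉ W} = ((U : Set V) \ (W : Set V)).ncard := rfl
  have h3 : (U : Set V).ncard = Nat.card F ^ Module.finrank F U :=
    Module.natCard_eq_pow_finrank (K := F) (V := U)
  have h4 : (W : Set V).ncard = Nat.card F ^ Module.finrank F W :=
    Module.natCard_eq_pow_finrank (K := F) (V := W)
  rw [h2]
  rw [h3, h4] at h1
  have := congrArg (Nat.cast (R := ℤ)) h1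
  push_cast at this
  linarith

/-- The number of Lagrangian subspaces containing a given isotropic subspace of codimension `k`
in a Lagrangian. -/
theorem card_lagrangian_ge (hB : B.IsAlt) (hn : B.Nondegenerate)
    (hV : Module.finrank F V = 2 * n) (k : ℕ) :
    ∀ W : Submodule F V, W ≤ B.orthogonal W → Module.finrank F W + k = n →
      (Nat.card {L : {L : Submodule F V // B.orthogonal L = L} // W ≤ L.1} : ℤ) =
        ∏ i ∈ Finset.range k, ((Nat.card F : ℤ) ^ (i + 1) + 1) := by
  classical
  have : Finite V := Module.finite_of_finite F
  induction k with
  | zero =>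
    intro W hW hr
    have hWL : B.orthogonal W = W := by
      refine (Submodule.eq_of_le_of_finrank_eq hW ?_).symm
      rw [LinearMap.BilinForm.finrank_orthogonal hn, hV]
      omega
    have : Nat.card {L : {L : Submodule F V // B.orthogonal L = L} // W ≤ L.1} = 1 := by
      rw [Nat.card_eq_one_iff_exists]
      refine ⟨⟨⟨W, hWL⟩, le_rfl⟩, ?_⟩
      rintro ⟨⟨L, hL⟩, hWL'⟩
      refine Subtype.ext (Subtype.ext (Submodule.eq_of_le_of_finrank_eq hWL' ?_).symm)
      rw [finrank_of_orthogonal_eq hn hV hL]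
      omega
    simp [this]
  | succ k ih =>
    intro W hW hr
    set q : ℤ := (Nat.card F : ℤ) with hq
    have hq1 : 1 < q := by rw [hq]; exact_mod_cast Finite.one_lt_card (α := F)
    set r := Module.finrank F W with hrdef
    have hWo : Module.finrank F (B.orthogonal W) = n + k + 1 := by
      rw [LinearMap.BilinForm.finrank_orthogonal hn, hV]; omega
    let LW := {L : {L : Submodule F V // B.orthogonal L = L} // W ≤ L.1}
    let X := {v : V // v ∈ B.orthogonal W ∧ v ∉ W}
    -- Double count of the pairs `(L, v)` with `W ≤ L` and `v ∈ L \ W`. Such a `v` lies in `W^⊥ \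
    -- W`, and the `L` belonging to it are those containing the larger isotropic space `W + ⟨v⟩`.
    have e : (Σ L : LW, {v : V // v ∈ L.1.1 ∧ v ∉ W}) ≃
        Σ v : X, {L : {L : Submodule F V // B.orthogonal L = L} //
          W ⊔ Submodule.span F {v.1} ≤ L.1} :=
      { toFun := fun p => ⟨⟨p.2.1, fun w hw => by
            have h : p.2.1 ∈ B.orthogonal p.1.1.1 := p.1.1.2.symm ▸ p.2.2.1
            exact h w (p.1.2 hw), p.2.2.2⟩, ⟨p.1.1, sup_le p.1.2 (by
              rw [Submodule.span_singleton_le_iff_mem]; exact p.2.2.1)⟩⟩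
        invFun := fun p => ⟨⟨p.2.1, le_sup_left.trans p.2.2⟩, ⟨p.1.1,
          p.2.2 (Submodule.mem_sup_right (Submodule.mem_span_singleton_self _)), p.1.2.2⟩⟩
        left_inv := fun p => rfl
        right_inv := fun p => rfl }
    have hc := Nat.card_congr e
    have := Fintype.ofFinite LW
    have := Fintype.ofFinite X
    rw [Nat.card_sigma, Nat.card_sigma] at hc
    have hc' := congrArg (Nat.cast (R := ℤ)) hc
    push_cast at hc'
    have hL : ∀ L : LW, (Nat.card {v : V // v ∈ L.1.1 ∧ v ∉ W} : ℤ) = q ^ n - q ^ r := by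
      intro L
      rw [card_diff_submodule L.2, finrank_of_orthogonal_eq hn hV L.1.2]
    have hX : ∀ v : X, (Nat.card {L : {L : Submodule F V // B.orthogonal L = L} //
        W ⊔ Submodule.span F {v.1} ≤ L.1} : ℤ) = ∏ i ∈ Finset.range k, (q ^ (i + 1) + 1) := by
      intro v
      refine ih _ (sup_span_singleton_isotropic hB hW v.2.1) ?_
      rw [finrank_sup_span_singleton v.2.2]
      omega
    rw [Finset.sum_congr rfl fun L _ => hL L, Finset.sum_congr rfl fun v _ => hX v,
      Finset.sum_const, Finset.sum_const, Finset.card_univ, Finset.card_univ,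
      Fintype.card_eq_nat_card, Fintype.card_eq_nat_card, nsmul_eq_mul, nsmul_eq_mul,
      card_diff_submodule hW, hWo, ← hq, ← hrdef] at hc'
    have hpos : q ^ n - q ^ r ≠ 0 := by
      have := pow_lt_pow_right₀ hq1 (show r < n by omega)
      omega
    refine mul_right_cancel₀ hpos (hc'.trans ?_)
    rw [Finset.prod_range_succ]
    -- The quotient of the two counts is `(q^(r+2(k+1)) - q^r) / (q^(r+k+1) - q^r) = q^(k+1) + 1`,
    -- the new factor of the product.
    have : n = r + (k + 1) := by omega
    rw [this]
    ring

/-- A subspace of dimension `r` is contained in at most the fraction `q ^ (r (r - 1) - n r)` of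
all Lagrangian subspaces. -/
theorem card_lagrangian_ge_le (hB : B.IsAlt) (hn : B.Nondegenerate)
    (hV : Module.finrank F V = 2 * n) (W : Submodule F V) :
    Nat.card F ^ (n * Module.finrank F W) *
      Nat.card {L : {L : Submodule F V // B.orthogonal L = L} // W ≤ L.1} ≤
    Nat.card F ^ (Module.finrank F W * (Module.finrank F W - 1)) *
      Nat.card {L : Submodule F V // B.orthogonal L = L} := by
  have : Finite V := Module.finite_of_finite F
  by_cases hW : W ≤ B.orthogonal W
  · obtain ⟨k, hk⟩ : ∃ k, Module.finrank F W + k = n := by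
      have h1 := Submodule.finrank_mono hW
      rw [LinearMap.BilinForm.finrank_orthogonal hn, hV] at h1
      have h2 := Submodule.finrank_le W
      exact ⟨n - Module.finrank F W, by omega⟩
    have h1 := card_lagrangian_ge hB hn hV k W hW hk
    have h0 := card_lagrangian_ge hB hn hV n ⊥ bot_le (by simp)
    have h0' : Nat.card {L : {L : Submodule F V // B.orthogonal L = L} // ⊥ ≤ L.1} =
        Nat.card {L : Submodule F V // B.orthogonal L = L} :=
      Nat.card_congr (Equiv.subtypeUnivEquiv fun _ => bot_le)
    rw [h0'] at h0
    set r := Module.finrank F W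
    zify
    rw [h1, h0]
    set q : ℤ := (Nat.card F : ℤ) with hq
    have hq1 : 1 < q := by rw [hq]; exact_mod_cast Finite.one_lt_card (α := F)
    rw [show n = k + r by omega, Finset.prod_range_add, ← mul_assoc, mul_comm (_ * _)
      (∏ x ∈ Finset.range r, _), ← mul_assoc]
    refine mul_le_mul_of_nonneg_right ?_ (Finset.prod_nonneg fun i _ => by positivity)
    -- The ratio of the two counts is the product of the top `r` factors, each at least `q^(k+1)`.
    have h2 : q ^ (k * r + r) ≤ ∏ x ∈ Finset.range r, (q ^ (k + x + 1) + 1) := by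
      calc q ^ (k * r + r) = ∏ x ∈ Finset.range r, q ^ (k + 1) := by
            rw [Finset.prod_const, Finset.card_range, ← pow_mul]; ring_nf
        _ ≤ _ := by
            refine Finset.prod_le_prod (fun i _ => by positivity) fun i _ => ?_
            have := pow_le_pow_right₀ hq1.le (show k + 1 ≤ k + i + 1 by omega)
            omega
    calc q ^ ((k + r) * r) = q ^ (k * r + r) * q ^ (r * (r - 1)) := by
          rw [← pow_add]
          congr 1
          rcases r with _ | r
          · simp
          · simp only [Nat.add_sub_cancel]; ring
      _ ≤ _ := mul_le_mul_of_nonneg_right h2 (by positivity)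
  -- Subspaces of a Lagrangian are isotropic, so otherwise the count is zero.
  · have : IsEmpty {L : {L : Submodule F V // B.orthogonal L = L} // W ≤ L.1} :=
      ⟨fun L => hW (L.2.trans (L.1.2.symm.le.trans (LinearMap.BilinForm.orthogonal_le L.2)))⟩
    have h := Nat.card_of_isEmpty (α := {L : {L : Submodule F V // B.orthogonal L = L} // W ≤ L.1})
    rw [h]
    simp

end Counting

/-! ### The standard symplectic form and the containment probability. -/

section Symplectic

variable {F : Type*} [Field F] {l N : ℕ}

theorem omega_apply (v w : Phase F l N) :
    omega F l N v w = ∑ a, ∑ n, ((v a n).1 * (w a n).2 - (v a n).2 * (w a n).1) := rfl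

theorem omega_isAlt : (omega F l N).IsAlt := by
  intro v
  rw [omega_apply]
  exact Finset.sum_eq_zero fun a _ => Finset.sum_eq_zero fun n _ => by ring

/-- If `v` is symplectically orthogonal to everything held by the party `a`, then `v a = 0`. -/
theorem eq_zero_of_omega_single (v : Phase F l N) (a : Fin l)
    (h : ∀ x, omega F l N v (Pi.single a x) = 0) : v a = 0 := by
  classical
  have key : ∀ n (p : F × F), (v a n).1 * p.2 - (v a n).2 * p.1 = 0 := by
    intro n p
    have h1 := h (Pi.single n p)
    rw [omega_apply, Finset.sum_eq_single a, Finset.sum_eq_single n] at h1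
    · simpa using h1
    · intro m _ hm; simp [hm]
    · simp
    · intro b _ hb; simp [hb]
    · simp
  funext n
  have h1 := key n (0, 1)
  have h2 := key n (1, 0)
  simp at h1 h2
  exact Prod.ext h1 h2

theorem omega_nondegenerate : (omega F l N).Nondegenerate := by
  have h : ∀ v, (∀ w, omega F l N v w = 0) → v = 0 := fun v hv =>
    funext fun a => eq_zero_of_omega_single v a fun x => hv _
  exact ⟨h, fun v hv => h v fun w => (LinearMap.BilinForm.IsAlt.eq_iff omega_isAlt).1 (hv w)⟩

theorem finrank_phase : Module.finrank F (Phase F l N) = 2 * (N * l) := by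
  simp [Phase, Module.finrank_pi_fintype]
  ring

theorem finrank_lagrangian (L : LGr F l N) : Module.finrank F L.1 = N * l :=
  finrank_of_orthogonal_eq omega_nondegenerate finrank_phase L.2

theorem mem_iff_omega (L : LGr F l N) (v : Phase F l N) :
    v ∈ L.1 ↔ ∀ w ∈ L.1, omega F l N v w = 0 := by
  conv_lhs => rw [← L.2]
  exact forall₂_congr fun w _ => LinearMap.BilinForm.IsAlt.eq_iff omega_isAlt

variable [Finite F]

theorem card_LGr_pos : 0 < Nat.card (LGr F l N) := by
  have h0 := card_lagrangian_ge (omega_isAlt (F := F)) (omega_nondegenerate)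
    (finrank_phase (F := F) (l := l) (N := N)) (N * l) ⊥ bot_le (by simp)
  have h0' : Nat.card {L : {L : Submodule F (Phase F l N) // (omega F l N).orthogonal L = L} //
      ⊥ ≤ L.1} = Nat.card (LGr F l N) :=
    Nat.card_congr (Equiv.subtypeUnivEquiv fun _ => bot_le)
  rw [h0'] at h0
  have : (0 : ℤ) < Nat.card (LGr F l N) := by
    rw [h0]; exact Finset.prod_pos fun i _ => by positivity
  exact_mod_cast this

instance : Nonempty (LGr F l N) := (Nat.card_pos_iff.1 card_LGr_pos).1

/-- The probability that a random Lagrangian contains a given subspace of dimension `r`. -/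
theorem prob_ge_le (W : Submodule F (Phase F l N)) :
    prob (fun L : LGr F l N => W ≤ L.1) ≤
      (Nat.card F : ℝ) ^ (Module.finrank F W * (Module.finrank F W - 1)) /
        (Nat.card F : ℝ) ^ (N * l * Module.finrank F W) := by
  have h := card_lagrangian_ge_le (omega_isAlt (F := F)) (omega_nondegenerate)
    (finrank_phase (F := F) (l := l) (N := N)) W
  have hq : (0 : ℝ) < Nat.card F := by exact_mod_cast Nat.card_pos
  have hL : (0 : ℝ) < Nat.card (LGr F l N) := by exact_mod_cast card_LGr_pos
  rw [prob, div_le_div_iff₀ hL (by positivity), mul_comm]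
  exact_mod_cast h

end Symplectic

/-! ### Contracting homotopies, and duality between degrees `k` and `l + 2 - k`. -/

section Duality

variable {F : Type*} [Field F] {l N : ℕ}

theorem delta_apply (c : Finset (Fin l) → Phase F l N) (T : Finset (Fin l)) :
    delta F l N c T = ∑ b ∈ T, sgn F T b • c (T.erase b) := rfl

theorem sgn_mul_self (T : Finset (Fin l)) (b : Fin l) : sgn F T b * sgn F T b = 1 := by
  rw [sgn, ← mul_pow]; simp

/-- The sign rule for removing two different parties, in either order. -/
theorem sgn_anticomm {T : Finset (Fin l)} {a b : Fin l} (ha : a ∈ T) (hb : b ∈ T) (hab : a ≠ b) :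
    sgn F T a * sgn F (T.erase a) b = -(sgn F T b * sgn F (T.erase b) a) := by
  rcases lt_or_gt_of_ne hab with h | h
  · exact sgn_swap ha h
  · rw [sgn_swap hb h, neg_neg]

/-- Contraction of the component at the party `a` with the party `p a`. -/
def contract (p : Fin l → Fin l) (c : Finset (Fin l) → Phase F l N) :
    Finset (Fin l) → Phase F l N :=
  fun S a => if p a ∈ S then 0 else sgn F (insert (p a) S) (p a) • c (insert (p a) S) a

/-- The cone homotopy of the full simplex, used separately in each component `a` with its own apex
`p a`. If `p a ∉ T`, the terms that remove some `b ∈ T` cancel in pairs by anticommutation of signs.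
-/
theorem delta_contract_add (p : Fin l → Fin l) (c : Finset (Fin l) → Phase F l N) :
    delta F l N (contract p c) + contract p (delta F l N c) = c := by
  funext T a
  rw [Pi.add_apply, Pi.add_apply, delta_apply, Finset.sum_apply]
  simp only [Pi.smul_apply, contract, delta_apply, Finset.sum_apply]
  by_cases hp : p a ∈ T
  · rw [if_pos hp, add_zero, Finset.sum_eq_single (p a)]
    · rw [if_neg (Finset.notMem_erase _ _), Finset.insert_erase hp, smul_smul, sgn_mul_self,
        one_smul]
    · intro b _ hb
      rw [if_pos (Finset.mem_erase.2 ⟨hb.symm, hp⟩), smul_zero]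
    · exact fun h => absurd hp h
  · rw [if_neg hp, Finset.sum_insert hp, Finset.erase_insert hp, smul_add, smul_smul,
      sgn_mul_self, one_smul, Finset.smul_sum, add_left_comm, ← Finset.sum_add_distrib,
      Finset.sum_eq_zero, add_zero]
    intro b hb
    have hbp : p a ≠ b := fun h => hp (h ▸ hb)
    rw [if_neg (fun h => hp (Finset.mem_of_mem_erase h)), Finset.erase_insert_of_ne hbp,
      smul_smul, smul_smul, ← add_smul]
    have h := sgn_anticomm (F := F) (Finset.mem_insert_self (p a) T)
      (Finset.mem_insert_of_mem hb) hbp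
    rw [Finset.erase_insert hp, Finset.erase_insert_of_ne hbp] at h
    have h1 := sgn_mul_self (F := F) (insert (p a) T) (p a)
    have h2 := sgn_mul_self (F := F) (insert (p a) T) b
    set x := sgn F (insert (p a) T) (p a)
    set y := sgn F (insert (p a) T) b
    have : sgn F T b * sgn F (insert (p a) (T.erase b)) (p a) + x * y = 0 := by
      linear_combination (x * sgn F (insert (p a) (T.erase b)) (p a)) * h -
        (sgn F T b * sgn F (insert (p a) (T.erase b)) (p a)) * h1 -
        x * y * sgn_mul_self (F := F) (insert (p a) (T.erase b)) (p a)
    rw [this, zero_smul]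

/-- Adding `p a ≠ a` to a set avoiding `a` still avoids `a`, so locality survives. Membership in `L`
is preserved instead when the apex is the same for all parties; a constant `p` has a fixed point, so
no `p` meets both conditions. Comparing the two kinds of contraction drives
`subsingleton_homology_of_dual`. -/
theorem contract_local (p : Fin l → Fin l) (hp : ∀ a, p a ≠ a)
    {c : Finset (Fin l) → Phase F l N} (hc : ∀ S, ∀ a ∉ S, c S a = 0) :
    ∀ S, ∀ a ∉ S, contract p c S a = 0 := by
  intro S a ha
  rw [contract]
  split_ifs
  · rfl
  · rw [hc _ a (by simp [ha, (hp a).symm]), smul_zero]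

theorem contract_const_mem (b : Fin l) (L : Submodule F (Phase F l N))
    {c : Finset (Fin l) → Phase F l N} (hc : ∀ S, c S ∈ L) (S : Finset (Fin l)) :
    contract (fun _ => b) c S ∈ L := by
  have : contract (fun _ => b) c S =
      if b ∈ S then 0 else sgn F (insert b S) b • c (insert b S) := by
    funext a
    rw [contract]
    split_ifs <;> rfl
  rw [this]
  split_ifs
  · exact L.zero_mem
  · exact L.smul_mem _ (hc _)

/-- The sign `(-1)^{∑ a ∈ S, a}`, which makes the differential self-adjoint. -/
def pairSign (F : Type*) [Field F] {l : ℕ} (S : Finset (Fin l)) : F := (-1) ^ (∑ a ∈ S, (a : ℕ))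

theorem pairSign_mul_self (S : Finset (Fin l)) : pairSign F S * pairSign F S = 1 := by
  rw [pairSign, ← mul_pow]; simp

/-- The `b` elements below `b` are divided between `S` and `Sᶜ`, so `(-1)^b` is the product of the
two removal signs. -/
theorem pairSign_insert {S : Finset (Fin l)} {b : Fin l} (hb : b ∉ S) :
    pairSign F (insert b S) * sgn F (insert b S) b = pairSign F S * sgn F Sᶜ b := by
  have h1 : (insert b S).filter (· < b) = S.filter (· < b) := by
    rw [Finset.filter_insert, if_neg (lt_irrefl b)]
  have h2 : (S.filter (· < b)).card + (Sᶜ.filter (· < b)).card = b := by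
    rw [← Finset.card_union_of_disjoint
      (Finset.disjoint_filter_filter disjoint_compl_right), ← Finset.filter_union,
      Finset.union_compl, Finset.filter_gt_eq_Iio, Fin.card_Iio]
  have h3 : sgn F S b * sgn F S b = 1 := sgn_mul_self S b
  have h4 : sgn F (insert b S) b = sgn F S b := by rw [sgn, h1, sgn]
  have h5 : ((-1 : F)) ^ (b : ℕ) = sgn F S b * sgn F Sᶜ b := by
    rw [sgn, sgn, ← pow_add, h2]
  rw [h4, pairSign, Finset.sum_insert hb, pow_add, h5, pairSign]
  linear_combination ((-1) ^ (∑ a ∈ S, (a : ℕ)) * sgn F Sᶜ b) * h3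

/-- The pairing of cochains in complementary degrees. -/
def pairing (c u : Finset (Fin l) → Phase F l N) : F :=
  ∑ S, pairSign F S * omega F l N (c Sᶜ) (u S)

/-- Both sides are sums over pairs of a set and an outside element, matched by `(S, b) ↦ (S ∪ {b},
b)`; `pairSign_insert` matches the signs. -/
theorem pairing_delta (c u : Finset (Fin l) → Phase F l N) :
    pairing (delta F l N c) u = pairing c (delta F l N u) := by
  have h1 : pairing (delta F l N c) u = ∑ S, ∑ b ∈ Sᶜ,
      pairSign F S * sgn F Sᶜ b * omega F l N (c (Sᶜ.erase b)) (u S) := by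
    refine Finset.sum_congr rfl fun S _ => ?_
    rw [delta_apply, map_sum, LinearMap.sum_apply, Finset.mul_sum]
    refine Finset.sum_congr rfl fun b _ => ?_
    rw [map_smul, LinearMap.smul_apply, smul_eq_mul, mul_assoc]
  have h2 : pairing c (delta F l N u) = ∑ T, ∑ b ∈ T,
      pairSign F T * sgn F T b * omega F l N (c Tᶜ) (u (T.erase b)) := by
    refine Finset.sum_congr rfl fun T _ => ?_
    rw [delta_apply, map_sum, Finset.mul_sum]
    refine Finset.sum_congr rfl fun b _ => ?_
    rw [map_smul, smul_eq_mul, mul_assoc]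
  rw [h1, h2, Finset.sum_sigma', Finset.sum_sigma']
  refine Finset.sum_bij' (fun p _ => ⟨insert p.2 p.1, p.2⟩) (fun p _ => ⟨p.1.erase p.2, p.2⟩)
    ?_ ?_ ?_ ?_ ?_
  · rintro ⟨S, b⟩ h; simp
  · rintro ⟨T, b⟩ h; simp
  · rintro ⟨S, b⟩ h
    simp at h
    simp [Finset.erase_insert h]
  · rintro ⟨T, b⟩ h
    simp at h
    simp [Finset.insert_erase h]
  · rintro ⟨S, b⟩ h
    simp only [Finset.mem_sigma, Finset.mem_univ, true_and, Finset.mem_compl] at h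
    dsimp only
    rw [pairSign_insert h, Finset.erase_insert h, Finset.compl_insert]

theorem exists_omega_eq (f : Phase F l N →ₗ[F] F) : ∃ c, ∀ v, omega F l N c v = f v := by
  refine ⟨(LinearMap.BilinForm.toDual (omega F l N) omega_nondegenerate).symm f, fun v => ?_⟩
  exact LinearMap.BilinForm.apply_toDual_symm_apply ..

/-- Nondegeneracy of `omega` represents `f` one set at a time. The second clause turns vanishing of
`f` on a cochain concentrated at `S` into orthogonality to `c Sᶜ`. -/
theorem exists_pairing_eq (f : (Finset (Fin l) → Phase F l N) →ₗ[F] F) :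
    ∃ c : Finset (Fin l) → Phase F l N, (∀ u, pairing c u = f u) ∧
      ∀ S x, pairSign F S * omega F l N (c Sᶜ) x = f (Pi.single S x) := by
  have h : ∀ S, ∃ d : Phase F l N, ∀ x, pairSign F S * omega F l N d x = f (Pi.single S x) := by
    intro S
    obtain ⟨d, hd⟩ := exists_omega_eq (f ∘ₗ LinearMap.single F (fun _ => Phase F l N) S)
    refine ⟨pairSign F S • d, fun x => ?_⟩
    rw [map_smul, LinearMap.smul_apply, smul_eq_mul, ← mul_assoc, pairSign_mul_self, one_mul, hd]
    rfl
  choose d hd using h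
  have hd' : ∀ S x, pairSign F S * omega F l N (d Sᶜᶜ) x = f (Pi.single S x) := by
    intro S x
    rw [compl_compl, hd]
  refine ⟨fun S => d Sᶜ, fun u => ?_, hd'⟩
  rw [pairing, Finset.sum_congr rfl fun S _ => hd' S (u S), ← map_sum, Finset.univ_sum_single]

/-- If there are no cocycles in degree `k`, then the complex of the spaces `V / (V_S + L)` is
exact in degree `l - k`. -/
theorem exists_sub_delta_mem (L : LGr F l N) {k i : ℕ} (hki : k + i = l)
    (hk : cocycles L.1 k = ⊥) (u : Finset (Fin l) → Phase F l N) :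
    ∃ t, ∀ S : Finset (Fin l), S.card = i →
      u S - delta F l N t S ∈ localPart ⊤ S ⊔ L.1 := by
  classical
  -- No condition is imposed outside degree `i`; hence a functional that kills `U` is represented by
  -- a cochain living only in degree `k = l - i`.
  let U : Submodule F (Finset (Fin l) → Phase F l N) :=
    { carrier := {u | ∀ S : Finset (Fin l), S.card = i → u S ∈ localPart ⊤ S ⊔ L.1}
      add_mem' := fun ha hb S hS => add_mem (ha S hS) (hb S hS)
      zero_mem' := fun S _ => zero_mem _
      smul_mem' := fun r _ ha S hS => Submodule.smul_mem _ r (ha S hS) }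
  suffices h : u ∈ LinearMap.range (delta F l N) ⊔ U by
    obtain ⟨_, ⟨t, rfl⟩, y, hy, rfl⟩ := Submodule.mem_sup.1 h
    refine ⟨t, fun S hS => ?_⟩
    rw [Pi.add_apply, add_sub_cancel_left]
    exact hy S hS
  by_contra hu
  obtain ⟨f, hfu, hf⟩ := Submodule.exists_le_ker_of_notMem hu
  obtain ⟨c, hc, hcs⟩ := exists_pairing_eq f
  have hU : ∀ S x, (S.card = i → x ∈ localPart ⊤ S ⊔ L.1) → omega F l N (c Sᶜ) x = 0 := by
    intro S x hx
    have h1 : f (Pi.single S x) = 0 := by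
      refine hf (Submodule.mem_sup_right ?_)
      intro T hT
      by_cases hTS : T = S
      · subst hTS; simpa using hx hT
      · simp [Pi.single_eq_of_ne hTS]
    rw [← hcs] at h1
    have h2 := pairSign_mul_self (F := F) S
    rcases mul_eq_zero.1 h1 with h | h
    · rw [h] at h2; simp at h2
    · exact h
  -- Orthogonality to `L` puts the values in `L`, since `L` is Lagrangian; orthogonality to `V_S`
  -- makes `c Sᶜ` local to `Sᶜ`; and `f` killing the range of `δ` gives `δ c = 0` by
  -- self-adjointness.
  have hcz : c ∈ cocycles L.1 k := by
    refine ⟨fun S => ⟨⟨?_, fun a ha => ?_⟩, fun hS => ?_⟩, ?_⟩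
    · rw [mem_iff_omega]
      intro w hw
      have := hU Sᶜ w fun _ => Submodule.mem_sup_right hw
      rwa [compl_compl] at this
    · refine eq_zero_of_omega_single _ a fun x => ?_
      have := hU Sᶜ (Pi.single a x) fun _ => Submodule.mem_sup_left
        ⟨trivial, fun b hb => Pi.single_eq_of_ne (fun h => hb (by simp [h, ha])) _⟩
      rwa [compl_compl] at this
    · refine funext fun a => eq_zero_of_omega_single _ a fun x => ?_
      have := hU Sᶜ (Pi.single a x) fun h => absurd h (by
        rw [Finset.card_compl, Fintype.card_fin]
        have := S.card_le_univ
        rw [Fintype.card_fin] at this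
        omega)
      rwa [compl_compl] at this
    · refine LinearMap.mem_ker.2 ?_
      funext S a
      refine eq_zero_of_omega_single _ a fun x => ?_
      have h1 : pairing (delta F l N c) (Pi.single Sᶜ (Pi.single a x)) = 0 := by
        rw [pairing_delta, hc]
        exact hf (Submodule.mem_sup_left ⟨_, rfl⟩)
      rw [pairing, Finset.sum_eq_single Sᶜ] at h1
      · rw [Pi.single_eq_same, compl_compl] at h1
        have h2 := pairSign_mul_self (F := F) Sᶜ
        rcases mul_eq_zero.1 h1 with h | h
        · rw [h] at h2; simp at h2
        · exact h
      · intro T _ hT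
        rw [Pi.single_eq_of_ne hT, map_zero, mul_zero]
      · simp
  rw [hk, Submodule.mem_bot] at hcz
  apply hfu
  rw [← hc, hcz]
  simp [pairing]

/-- The part of a cochain in one degree. -/
def degreePart (j : ℕ) (c : Finset (Fin l) → Phase F l N) : Finset (Fin l) → Phase F l N :=
  fun S => if S.card = j then c S else 0

theorem delta_degreePart (j : ℕ) (c : Finset (Fin l) → Phase F l N) :
    delta F l N (degreePart j c) = degreePart (j + 1) (delta F l N c) := by
  funext T
  rw [delta_apply, degreePart, delta_apply]
  split_ifs with h
  · refine Finset.sum_congr rfl fun b hb => ?_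
    rw [degreePart, if_pos (by rw [Finset.card_erase_of_mem hb, h]; rfl)]
  · refine Finset.sum_eq_zero fun b hb => ?_
    rw [degreePart, if_neg, smul_zero]
    have := Finset.card_erase_add_one hb
    omega

theorem degreePart_eq_self {L : Submodule F (Phase F l N)} {j : ℕ}
    {c : Finset (Fin l) → Phase F l N} (hc : c ∈ chains L j) : degreePart j c = c := by
  funext S
  rw [degreePart]
  split_ifs with h
  · rfl
  · exact ((hc S).2 h).symm

theorem chains_eq_bot_of_lt (L : Submodule F (Phase F l N)) {j : ℕ} (hj : l < j) :
    chains L j = ⊥ := by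
  rw [eq_bot_iff]
  intro c hc
  rw [Submodule.mem_bot]
  funext S
  refine (hc S).2 ?_
  have := S.card_le_univ
  rw [Fintype.card_fin] at this
  omega

theorem subsingleton_homology {L : Submodule F (Phase F l N)} {j : ℕ}
    (h : cocycles L j ≤ coboundaries L j) : Subsingleton (Homology L j) := by
  rw [Submodule.Quotient.subsingleton_iff, Submodule.submoduleOf_eq_top]
  exact h

/-- The vanishing half of the duality between the homology in degrees `k` and `l + 2 - k`. -/
theorem subsingleton_homology_of_dual (hl : 2 ≤ l) (L : LGr F l N) {j k : ℕ}
    (hjk : j + k = l + 2) (hk2 : 2 ≤ j) (hk : cocycles L.1 k = ⊥) :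
    Subsingleton (Homology L.1 j) := by
  obtain ⟨i, rfl⟩ : ∃ i, j = i + 2 := ⟨j - 2, by omega⟩
  refine subsingleton_homology fun c hc => ?_
  obtain ⟨hc, hδ⟩ := hc
  replace hδ : delta F l N c = 0 := LinearMap.mem_ker.1 hδ
  have hl0 : 0 < l := by omega
  let o : Fin l := ⟨0, hl0⟩
  -- Party 1, which exists as `l ≥ 2`, serves as apex for party 0, and party 0 for all others.
  let p : Fin l → Fin l := fun a => if a = o then ⟨1, hl⟩ else o
  have hp : ∀ a, p a ≠ a := by
    intro a
    simp only [p]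
    split_ifs with h
    · rw [h]; simp [o]
    · exact fun h' => h h'.symm
  have hzero : ∀ p' : Fin l → Fin l, contract p' (0 : Finset (Fin l) → Phase F l N) = 0 := by
    intro p'
    funext S a
    simp [contract]
  -- Both `v` (local) and `w` (in `L`) are primitives of `c`, and `v = δ u + w`. A primitive lying
  -- in `C^(i+1) L` must be both local and in `L`; correcting `v` to one amounts to splitting `u`
  -- modulo `δ t` as `x + y` with `x` local and `y` in `L`.
  set v := contract p c with hv
  have hvl : ∀ S, ∀ a ∉ S, v S a = 0 := contract_local p hp fun S => (hc S).1.2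
  have hδv : delta F l N v = c := by
    have := delta_contract_add p c
    rwa [hδ, hzero, add_zero] at this
  set w := contract (fun _ => o) c with hw
  have hwL : ∀ S, w S ∈ L.1 := contract_const_mem o L.1 fun S => (hc S).1.1
  set u := contract (fun _ => o) v with hu
  have huv : delta F l N u + w = v := by
    have := delta_contract_add (fun _ => o) v
    rwa [hδv] at this
  obtain ⟨t, ht⟩ := exists_sub_delta_mem L (show k + i = l by omega) hk u
  have hdec : ∀ S : Finset (Fin l), ∃ x y, x ∈ localPart ⊤ S ∧ y ∈ L.1 ∧
      (S.card = i → x + y = u S - delta F l N t S) := by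
    intro S
    by_cases hS : S.card = i
    · obtain ⟨x, hx, y, hy, hxy⟩ := Submodule.mem_sup.1 (ht S hS)
      exact ⟨x, y, hx, hy, fun _ => hxy⟩
    · exact ⟨0, 0, zero_mem _, zero_mem _, fun h => absurd h hS⟩
  choose x y hx hy hxy using hdec
  have hxyu : degreePart (i + 1) (delta F l N x) + degreePart (i + 1) (delta F l N y) =
      degreePart (i + 1) (delta F l N u) := by
    rw [← delta_degreePart, ← delta_degreePart, ← map_add]
    have : degreePart i x + degreePart i y = degreePart i (u - delta F l N t) := by
      funext S
      simp only [Pi.add_apply, degreePart]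
      split_ifs with hS
      · exact hxy S hS
      · simp
    rw [this, delta_degreePart, LinearMap.map_sub, delta_delta, sub_zero]
  -- In degree `i + 1`, `v - δ x` is visibly local and equals `δ y + w`, which lies in `L`.
  -- Truncation is needed because the splitting of `u` is known only in degree `i`.
  refine ⟨degreePart (i + 1) (v - delta F l N x), fun S => ⟨⟨?_, fun a ha => ?_⟩, fun hS => ?_⟩, ?_⟩
  · have h := congrFun hxyu S
    simp only [Pi.add_apply, degreePart] at h ⊢
    split_ifs at h ⊢ with hS
    · have : (v - delta F l N x) S = delta F l N y S + w S := by
        rw [Pi.sub_apply, ← huv, Pi.add_apply, ← h]; abel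
      rw [this]
      exact add_mem (Submodule.sum_mem _ fun b _ => Submodule.smul_mem _ _ (hy _)) (hwL S)
    · exact zero_mem _
  · rw [degreePart]
    split_ifs
    · rw [Pi.sub_apply, Pi.sub_apply, hvl S a ha, delta_apply, Finset.sum_apply,
        Finset.sum_eq_zero, sub_zero]
      intro b _
      rw [Pi.smul_apply, (hx _).2 a fun h => ha (Finset.mem_of_mem_erase h), smul_zero]
    · rfl
  · rw [degreePart, if_neg hS]
  · rw [delta_degreePart, LinearMap.map_sub, delta_delta, sub_zero, hδv, degreePart_eq_self hc]

/-- The vectors supported at a set of parties are the functions on this set. -/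
def localTopEquiv (S : Finset (Fin l)) :
    localPart (⊤ : Submodule F (Phase F l N)) S ≃ₗ[F] (S → Fin N → F × F) where
  toFun v a := v.1 a
  map_add' _ _ := rfl
  map_smul' _ _ := rfl
  invFun w := ⟨fun a => if h : a ∈ S then w ⟨a, h⟩ else 0, trivial, fun a ha => dif_neg ha⟩
  left_inv v := by
    refine Subtype.ext (funext fun a => ?_)
    by_cases h : a ∈ S
    · simp [h]
    · simp [h, v.2.2 a h]
  right_inv w := by
    funext a
    simp

theorem finrank_localPart_top (S : Finset (Fin l)) :
    Module.finrank F (localPart (⊤ : Submodule F (Phase F l N)) S) = 2 * N * S.card := by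
  rw [(localTopEquiv S).finrank_eq]
  simp [Module.finrank_pi_fintype]
  ring

/-- The orthogonal complement of `L + V_S` is `L ∩ V_{Sᶜ}`; compare dimensions. -/
theorem finrank_localPart_add (L : LGr F l N) (S : Finset (Fin l)) :
    Module.finrank F (localPart L.1 S) + N * l =
      2 * N * S.card + Module.finrank F (localPart L.1 Sᶜ) := by
  have h1 : localPart L.1 S = L.1 ⊓ localPart ⊤ S := by
    ext v
    exact ⟨fun h => ⟨h.1, trivial, h.2⟩, fun h => ⟨h.1, h.2.2⟩⟩
  have h2 : (omega F l N).orthogonal (L.1 ⊔ localPart ⊤ S) = localPart L.1 Sᶜ := by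
    ext v
    rw [LinearMap.BilinForm.mem_orthogonal_iff]
    constructor
    · refine fun h => ⟨?_, fun a ha => ?_⟩
      · rw [← L.2]
        exact fun w hw => h w (Submodule.mem_sup_left hw)
      · refine eq_zero_of_omega_single _ a fun x => ?_
        rw [LinearMap.BilinForm.IsAlt.eq_iff omega_isAlt]
        refine h _ (Submodule.mem_sup_right ⟨trivial, fun b hb => Pi.single_eq_of_ne ?_ _⟩)
        rintro rfl
        simp at ha
        exact hb ha
    · intro h w hw
      obtain ⟨x, hx, y, hy, rfl⟩ := Submodule.mem_sup.1 hw
      have hx0 : omega F l N x v = 0 := by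
        have := h.1
        rw [← L.2] at this
        exact this x hx
      rw [map_add, LinearMap.add_apply, hx0, zero_add, omega_apply]
      refine Finset.sum_eq_zero fun a _ => Finset.sum_eq_zero fun n _ => ?_
      by_cases ha : a ∈ S
      · rw [h.2 a (by simp [ha])]; simp
      · rw [hy.2 a ha]; simp
  have h3 := Submodule.finrank_sup_add_finrank_inf_eq L.1 (localPart ⊤ S)
  have h4 := LinearMap.BilinForm.finrank_orthogonal omega_nondegenerate (L.1 ⊔ localPart ⊤ S)
  have h5 := Submodule.finrank_le (L.1 ⊔ localPart ⊤ S)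
  rw [h2, finrank_phase] at h4
  rw [finrank_phase] at h5
  rw [← h1, finrank_lagrangian, finrank_localPart_top] at h3
  omega

end Duality

/-! ### Expectation, union bound and Markov-type estimates. -/

section ProbabilityLemmas

variable {F : Type*} [Field F] {l N : ℕ}

theorem expect_mul_left (r : ℝ) (X : LGr F l N → ℝ) :
    expect (fun L => r * X L) = r * expect X := by
  rw [expect, expect, ← mul_finsum, mul_div_assoc]

theorem prob_nonneg (E : LGr F l N → Prop) : 0 ≤ prob E := by unfold prob; positivity

variable [Finite F]

theorem card_LGr_pos' : (0 : ℝ) < Nat.card (LGr F l N) := by exact_mod_cast card_LGr_pos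

theorem expect_mono {X Y : LGr F l N → ℝ} (h : ∀ L, X L ≤ Y L) : expect X ≤ expect Y := by
  have := Fintype.ofFinite (LGr F l N)
  rw [expect, expect, finsum_eq_sum_of_fintype, finsum_eq_sum_of_fintype]
  exact div_le_div_of_nonneg_right (Finset.sum_le_sum fun L _ => h L) card_LGr_pos'.le

theorem expect_sum {ι : Type*} (s : Finset ι) (X : ι → LGr F l N → ℝ) :
    expect (fun L => ∑ i ∈ s, X i L) = ∑ i ∈ s, expect (X i) := by
  simp only [expect]
  rw [finsum_sum_comm _ _ fun _ _ => Set.toFinite _, Finset.sum_div]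

theorem expect_add (X Y : LGr F l N → ℝ) :
    expect (fun L => X L + Y L) = expect X + expect Y := by
  rw [expect, expect, expect, finsum_add_distrib (Set.toFinite _) (Set.toFinite _), add_div]

theorem expect_const (r : ℝ) : expect (fun _ : LGr F l N => r) = r := by
  have := Fintype.ofFinite (LGr F l N)
  rw [expect, finsum_eq_sum_of_fintype, Finset.sum_const, Finset.card_univ,
    Fintype.card_eq_nat_card, nsmul_eq_mul, mul_div_cancel_left₀ _ card_LGr_pos'.ne']

theorem abs_expect_sub_le {X D : LGr F l N → ℝ} {r : ℝ} (h : ∀ L, |X L - r| ≤ D L) :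
    |expect X - r| ≤ expect D := by
  rw [abs_le]
  constructor
  · have := expect_mono (X := fun _ => r) (Y := fun L => X L + D L)
      fun L => by linarith [(abs_le.1 (h L)).1]
    rw [expect_const, expect_add] at this
    linarith
  · have := expect_mono (X := X) (Y := fun L => r + D L)
      fun L => by linarith [(abs_le.1 (h L)).2]
    rw [expect_add, expect_const] at this
    linarith

open Classical in
theorem prob_eq_expect (E : LGr F l N → Prop) :
    prob E = expect fun L => if E L then (1 : ℝ) else 0 := by
  have := Fintype.ofFinite (LGr F l N)
  rw [prob, expect, finsum_eq_sum_of_fintype, Finset.sum_boole, Nat.card_eq_fintype_card,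
    Fintype.card_subtype]

theorem prob_le_expect {E : LGr F l N → Prop} {X : LGr F l N → ℝ} (h0 : ∀ L, 0 ≤ X L)
    (h1 : ∀ L, E L → 1 ≤ X L) : prob E ≤ expect X := by
  classical
  rw [prob_eq_expect]
  refine expect_mono fun L => ?_
  split_ifs with h
  · exact h1 L h
  · exact h0 L

theorem prob_mono {E E' : LGr F l N → Prop} (h : ∀ L, E L → E' L) : prob E ≤ prob E' := by
  classical
  rw [prob_eq_expect E']
  refine prob_le_expect (fun L => ?_) fun L hL => ?_
  · split_ifs <;> norm_num
  · rw [if_pos (h L hL)]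

theorem prob_le_sum {ι : Type*} (s : Finset ι) {E : LGr F l N → Prop}
    (E' : ι → LGr F l N → Prop) (h : ∀ L, E L → ∃ i ∈ s, E' i L) :
    prob E ≤ ∑ i ∈ s, prob (E' i) := by
  classical
  simp only [prob_eq_expect (E' _)]
  rw [← expect_sum]
  have h0 : ∀ L, ∀ i ∈ s, (0 : ℝ) ≤ if E' i L then 1 else 0 := fun L i _ => by
    split_ifs <;> norm_num
  refine prob_le_expect (fun L => Finset.sum_nonneg (h0 L)) fun L hL => ?_
  obtain ⟨i, hi, hiL⟩ := h L hL
  refine le_trans ?_ (Finset.single_le_sum (h0 L) hi)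
  rw [if_pos hiL]

end ProbabilityLemmas

/-! ### A strict rank inequality for middle-degree cocycles of the simplex. -/

section Rank

variable {F : Type*} [Field F]

/-- Consider a cocycle of degree `m` of the full simplex on `2m` vertices with coefficients in `U`,
whose values span `U ≠ 0`.  Then the spans of its values on the sets that avoid a vertex `p` have
average dimension greater than half of `dim U`. -/
theorem mul_finrank_lt_sum_finrank {U : Type*} [AddCommGroup U] [Module F U]
    [FiniteDimensional F U] {l m : ℕ} (hlm : l = 2 * m) (hm : 0 < m) (z : Finset (Fin l) → U)
    (hz : ∀ S, S.card ≠ m → z S = 0) (hδ : ∀ T, ∑ b ∈ T, sgn F T b • z (T.erase b) = 0)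
    (hspan : Submodule.span F (Set.range z) = ⊤) (hU : 0 < Module.finrank F U) :
    m * Module.finrank F U < ∑ p, Module.finrank F (Submodule.span F (z '' {S | p ∉ S})) := by
  classical
  -- Choose a basis of `U` among the values `z (s i)`. Each `s i` misses `m` of the `2m` vertices,
  -- so counting basis vectors that avoid `p` already gives the weak inequality.
  obtain ⟨κ, s, hs, hsp, hli⟩ := exists_linearIndependent' F z
  have : Fintype κ := Fintype.ofInjective s hs
  let b : Module.Basis κ F U := Module.Basis.mk hli (by rw [hsp, hspan])
  have hb : ∀ i, b i = z (s i) := fun i => by simp [b]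
  have hcard : ∀ i, (s i).card = m := fun i => by
    by_contra h
    exact b.ne_zero i (by rw [hb, hz _ h])
  have hr : Module.finrank F U = Fintype.card κ := Module.finrank_eq_card_basis b
  have hB : ∀ p, Module.finrank F (Submodule.span F (b '' {i | p ∉ s i})) =
      (Finset.univ.filter fun i => p ∉ s i).card := by
    intro p
    rw [Set.image_eq_range]
    have h := finrank_span_eq_card (R := F) (b := fun i : {i | p ∉ s i} => b i)
      (b.linearIndependent.comp _ Subtype.val_injective)
    rw [h, ← Fintype.card_subtype]
    rfl
  have hle : ∀ p, Submodule.span F (b '' {i | p ∉ s i}) ≤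
      Submodule.span F (z '' {S | p ∉ S}) := by
    intro p
    refine Submodule.span_mono ?_
    rintro _ ⟨i, hi, rfl⟩
    exact ⟨s i, hi, (hb i).symm⟩
  have hsum : ∑ p, (Finset.univ.filter fun i => p ∉ s i).card = m * Module.finrank F U := by
    simp only [Finset.card_filter]
    rw [Finset.sum_comm]
    have : ∀ i, ∑ p, (if p ∉ s i then 1 else 0) = m := by
      intro i
      rw [← Finset.card_filter]
      have h1 : (Finset.univ.filter fun p => p ∉ s i) = (s i)ᶜ := by ext; simp
      rw [h1, Finset.card_compl, hcard, Fintype.card_fin]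
      omega
    rw [Finset.sum_congr rfl fun i _ => this i, Finset.sum_const, Finset.card_univ, hr,
      smul_eq_mul, mul_comm]
  by_contra hcon
  have hmono : ∀ p ∈ Finset.univ, (Finset.univ.filter fun i => p ∉ s i).card ≤
      Module.finrank F (Submodule.span F (z '' {S | p ∉ S})) := fun p _ => by
    rw [← hB]
    exact Submodule.finrank_mono (hle p)
  have heq := (Finset.sum_eq_sum_iff_of_le hmono).1
    (le_antisymm (Finset.sum_le_sum hmono) (by rw [hsum]; omega))
  have hspan' : ∀ p, Submodule.span F (b '' {i | p ∉ s i}) =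
      Submodule.span F (z '' {S | p ∉ S}) := fun p =>
    Submodule.eq_of_le_of_finrank_eq (hle p) (by rw [hB]; exact heq p (Finset.mem_univ p))
  -- In the equality case every span is generated by the basis vectors it contains. So a basis
  -- vector `b i` occurring in `z S` has `s i ⊆ S`, and equality holds by cardinality.
  have hrepr : ∀ S i, b.repr (z S) i ≠ 0 → s i = S := by
    intro S i hi
    have hS : S.card = m := by
      by_contra h
      rw [hz S h] at hi
      simp at hi
    refine Finset.eq_of_subset_of_card_le (fun p hp => ?_) (by rw [hS, hcard])
    by_contra hpS
    have h1 : z S ∈ Submodule.span F (b '' {i | p ∉ s i}) := by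
      rw [hspan']
      exact Submodule.subset_span ⟨S, hpS, rfl⟩
    exact (b.mem_span_image.1 h1 (Finsupp.mem_support_iff.2 hi)) hp
  have hne : Nonempty κ := Fintype.card_pos_iff.1 (hr ▸ hU)
  obtain ⟨i⟩ := hne
  obtain ⟨p, hp⟩ : ∃ p, p ∉ s i := by
    by_contra! h
    have h1 : s i = Finset.univ := Finset.eq_univ_iff_forall.2 h
    have h2 := hcard i
    rw [h1, Finset.card_univ, Fintype.card_fin] at h2
    omega
  -- In the cocycle relation at `s i ∪ {p}` only the face `s i` involves `b i`, with coefficient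
  -- `±1`: a contradiction.
  have h := congrArg (fun x => b.repr x i) (hδ (insert p (s i)))
  simp only [map_sum, map_smul, map_zero, Finsupp.coe_zero, Pi.zero_apply,
    Finsupp.coe_finsetSum, Finset.sum_apply, Finsupp.smul_apply, smul_eq_mul] at h
  rw [Finset.sum_eq_single p, Finset.erase_insert hp, ← hb, Module.Basis.repr_self,
    Finsupp.single_eq_same, mul_one] at h
  · have h1 := sgn_mul_self (F := F) (insert p (s i)) p
    rw [h] at h1
    simp at h1
  · intro c _ hcp
    by_contra hc
    have h1 := hrepr _ i (right_ne_zero_of_mul hc)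
    exact hp (h1 ▸ Finset.mem_erase.2 ⟨hcp.symm, Finset.mem_insert_self _ _⟩)
  · intro h
    exact absurd (Finset.mem_insert_self _ _) h

end Rank

/-! ### Almost sure absence of cocycles in degree `l/2`. -/

section MiddleCocycles

variable {F : Type*} [Field F] {l N : ℕ}

theorem dotProduct_nondegenerate (r : ℕ) :
    (dotProductBilin F F : LinearMap.BilinForm F (Fin r → F)).Nondegenerate := by
  have h : ∀ v : Fin r → F, (∀ w, dotProduct v w = 0) → v = 0 := fun v hv =>
    dotProduct_eq_zero v hv
  exact ⟨h, fun v hv => h v fun w => by rw [dotProduct_comm]; exact hv w⟩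

/-- The vectors orthogonal to the coefficients `z S` of all sets `S` avoiding the party `a`. -/
def coeffOrthogonal {r : ℕ} (z : Finset (Fin l) → Fin r → F) (a : Fin l) :
    Submodule F (Fin r → F) :=
  LinearMap.BilinForm.orthogonal (dotProductBilin F F : LinearMap.BilinForm F (Fin r → F))
    (Submodule.span F (z '' {S | a ∉ S}))

theorem mem_coeffOrthogonal {r : ℕ} {z : Finset (Fin l) → Fin r → F} {a : Fin l}
    {x : Fin r → F} (h : ∀ S, a ∉ S → ∑ i, z S i * x i = 0) : x ∈ coeffOrthogonal z a := by
  intro y hy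
  refine Submodule.span_induction ?_ ?_ ?_ ?_ hy
  · rintro _ ⟨S, hS, rfl⟩
    exact h S hS
  · simp
  · intro y y' _ _ h1 h2
    simp [h1, h2]
  · intro c y _ h1
    simp [h1]

theorem finrank_coeffOrthogonal {r : ℕ} (z : Finset (Fin l) → Fin r → F) (a : Fin l) :
    Module.finrank F (coeffOrthogonal z a) +
      Module.finrank F (Submodule.span F (z '' {S | a ∉ S})) = r := by
  have h := LinearMap.BilinForm.finrank_orthogonal (dotProduct_nondegenerate (F := F) r)
    (Submodule.span F (z '' {S | a ∉ S}))
  have h2 := Submodule.finrank_le (Submodule.span F (z '' {S | a ∉ S}))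
  rw [Module.finrank_fin_fun] at h h2
  rw [coeffOrthogonal, h]
  omega

/-- The tuples `w` for which each combination `∑ i, z S i • w i` is local to `S`. -/
def compatible (N : ℕ) {r : ℕ} (z : Finset (Fin l) → Fin r → F) : Set (Fin r → Phase F l N) :=
  {w | ∀ S, ∀ a ∉ S, ∑ i, z S i • w i a = 0}

variable [Finite F]

/-- Compatibility decouples: for each party `a`, each qudit and each of its two coordinates, the
resulting vector in `F^r` lies in `coeffOrthogonal z a`. -/
theorem card_compatible_le {r : ℕ} (z : Finset (Fin l) → Fin r → F) :
    Nat.card (compatible N z) ≤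
      Nat.card F ^ (2 * N * ∑ a, Module.finrank F (coeffOrthogonal z a)) := by
  let g : compatible N z → ∀ a : Fin l, Fin N → coeffOrthogonal z a × coeffOrthogonal z a :=
    fun w a n => (⟨fun i => (w.1 i a n).1, mem_coeffOrthogonal fun S hS => by
        have := congrArg Prod.fst (congrFun (w.2 S a hS) n)
        simpa [Prod.fst_sum] using this⟩,
      ⟨fun i => (w.1 i a n).2, mem_coeffOrthogonal fun S hS => by
        have := congrArg Prod.snd (congrFun (w.2 S a hS) n)
        simpa [Prod.snd_sum] using this⟩)
  have hg : Function.Injective g := by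
    intro w w' h
    refine Subtype.ext (funext fun i => funext fun a => funext fun n => ?_)
    have h1 := congrFun (congrFun h a) n
    exact Prod.ext (congrFun (congrArg (fun p => p.1.1) h1) i)
      (congrFun (congrArg (fun p => p.2.1) h1) i)
  refine (Nat.card_le_card_of_injective g hg).trans (le_of_eq ?_)
  rw [Nat.card_pi, Finset.mul_sum, ← Finset.prod_pow_eq_pow_sum]
  refine Finset.prod_congr rfl fun a _ => ?_
  rw [Nat.card_fun, Nat.card_prod, Module.natCard_eq_pow_finrank (K := F), Nat.card_fin]
  ring

/-- In the middle degree `m`, where `l = 2m`, there are asymptotically almost surely no nonzero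
cocycles. -/
theorem prob_cocycles_le {m : ℕ} (hlm : l = 2 * m) (hm : 0 < m) :
    ∃ C : ℝ, ∀ N : ℕ, prob (fun L : LGr F l N => cocycles L.1 m ≠ ⊥) ≤ C / (Nat.card F : ℝ) ^ N := by
  classical
  have := Fintype.ofFinite F
  set q : ℝ := (Nat.card F : ℝ) with hqdef
  have hq : 1 < q := by rw [hqdef]; exact_mod_cast Finite.one_lt_card (α := F)
  let good : ∀ r : ℕ, (Finset (Fin l) → Fin r → F) → Prop := fun r z =>
    (∀ S, S.card ≠ m → z S = 0) ∧ (∀ T, ∑ b ∈ T, sgn F T b • z (T.erase b) = 0) ∧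
      Submodule.span F (Set.range z) = ⊤ ∧ 0 < r
  -- The union bound runs over dimensions `r ≤ 2^l` and coefficient families `z`, finitely many
  -- independently of `N`; `q^(r(r-1))` comes from `prob_ge_le`.
  refine ⟨∑ r ∈ Finset.range (2 ^ l + 1), ∑ _z : Finset (Fin l) → Fin r → F,
    q ^ (r * (r - 1)), fun N => ?_⟩
  rw [Finset.sum_div]
  refine (prob_le_sum (Finset.range (2 ^ l + 1)) (fun r L => ∃ z, good r z ∧
    ∃ w ∈ compatible N z, LinearIndependent F w ∧ Submodule.span F (Set.range w) ≤ L.1)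
    ?_).trans (Finset.sum_le_sum fun r _ => ?_)
  · intro L hL
    obtain ⟨c, hc, hc0⟩ := Submodule.exists_mem_ne_zero_of_ne_bot hL
    obtain ⟨hc, hδ⟩ := hc
    replace hδ : delta F l N c = 0 := LinearMap.mem_ker.1 hδ
    let W := Submodule.span F (Set.range c)
    have hWr : Module.finrank F W ≤ 2 ^ l := by
      have := finrank_range_le_card (R := F) c
      rwa [Fintype.card_finset, Fintype.card_fin] at this
    refine ⟨Module.finrank F W, Finset.mem_range.2 (by omega), ?_⟩
    let b := Module.finBasis F W
    have hcW : ∀ S, c S ∈ W := fun S => Submodule.subset_span ⟨S, rfl⟩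
    let e : W ≃ₗ[F] (Fin (Module.finrank F W) → F) := b.equivFun
    have hrepr : ∀ S, ∑ i, e ⟨c S, hcW S⟩ i • (b i : Phase F l N) = c S := by
      intro S
      have := congrArg W.subtype (b.sum_equivFun ⟨c S, hcW S⟩)
      rw [map_sum] at this
      exact this
    refine ⟨fun S => e ⟨c S, hcW S⟩, ⟨fun S hS => ?_, fun T => ?_, ?_, ?_⟩,
      fun i => (b i : Phase F l N), fun S a ha => ?_, ?_, ?_⟩
    · change e ⟨c S, hcW S⟩ = 0
      rw [show (⟨c S, hcW S⟩ : W) = 0 from Subtype.ext ((hc S).2 hS), map_zero]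
    · simp only [← map_smul, ← map_sum]
      rw [← map_zero e]
      congr 1
      refine Subtype.ext ?_
      have := congrFun hδ T
      rw [delta_apply] at this
      simpa using this
    · have h1 : Submodule.span F (Set.range fun S => (⟨c S, hcW S⟩ : W)) = ⊤ := by
        rw [eq_top_iff]
        rintro ⟨x, hx⟩ _
        have h2 : Set.range c = W.subtype '' Set.range fun S => (⟨c S, hcW S⟩ : W) := by
          rw [← Set.range_comp]; rfl
        have h3 : x ∈ Submodule.map W.subtype
            (Submodule.span F (Set.range fun S => (⟨c S, hcW S⟩ : W))) := by
          rw [Submodule.map_span, ← h2]; exact hx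
        obtain ⟨y, hy, rfl⟩ := h3
        exact hy
      have h2 : (Set.range fun S => e ⟨c S, hcW S⟩) =
          (e : W →ₗ[F] _) '' Set.range fun S => (⟨c S, hcW S⟩ : W) := by
        rw [← Set.range_comp]; rfl
      rw [h2, ← Submodule.map_span, h1, Submodule.map_top, LinearEquiv.range]
    · rw [Nat.pos_iff_ne_zero]
      intro h0
      have hW0 : W = ⊥ := Submodule.finrank_eq_zero.1 h0
      exact hc0 (funext fun S => (Submodule.mem_bot F).1 (hW0 ▸ hcW S))
    · have h1 := congrFun (hrepr S) a
      rw [(hc S).1.2 a ha, Finset.sum_apply] at h1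
      exact h1
    · exact b.linearIndependent.map' W.subtype (Submodule.ker_subtype _)
    · rw [Submodule.span_le]
      rintro _ ⟨i, rfl⟩
      have : W ≤ L.1 := by
        rw [Submodule.span_le]
        rintro _ ⟨S, rfl⟩
        exact (hc S).1.1
      exact this (b i).2
  rw [Finset.sum_div]
  refine (prob_le_sum Finset.univ (fun z L => good r z ∧
    ∃ w ∈ compatible N z, LinearIndependent F w ∧ Submodule.span F (Set.range w) ≤ L.1)
    fun L ⟨z, hz⟩ => ⟨z, Finset.mem_univ z, hz⟩).trans (Finset.sum_le_sum fun z _ => ?_)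
  by_cases hz : good r z
  swap
  · have : (fun L : LGr F l N => good r z ∧ ∃ w ∈ compatible N z, LinearIndependent F w ∧
        Submodule.span F (Set.range w) ≤ L.1) = fun _ => False := by
      funext L; simp [hz]
    rw [this, prob]
    simp
    positivity
  have hfin : Finite (compatible N z) := inferInstance
  have := Fintype.ofFinite (compatible N z)
  refine (prob_le_sum (Finset.univ : Finset (compatible N z)) (fun w L =>
    LinearIndependent F w.1 ∧ Submodule.span F (Set.range w.1) ≤ L.1)
    fun L ⟨_, w, hw, h⟩ => ⟨⟨w, hw⟩, Finset.mem_univ _, h⟩).trans ?_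
  have hterm : ∀ w : compatible N z, prob (fun L : LGr F l N => LinearIndependent F w.1 ∧
      Submodule.span F (Set.range w.1) ≤ L.1) ≤ q ^ (r * (r - 1)) / q ^ (N * l * r) := by
    intro w
    by_cases hw : LinearIndependent F w.1
    · have h := prob_ge_le (Submodule.span F (Set.range w.1))
      rw [finrank_span_eq_card hw, Fintype.card_fin] at h
      exact (prob_mono fun L hL => hL.2).trans h
    · have : (fun L : LGr F l N => LinearIndependent F w.1 ∧
          Submodule.span F (Set.range w.1) ≤ L.1) = fun _ => False := by
        funext L; simp [hw]
      rw [this, prob]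
      simp
      positivity
  refine (Finset.sum_le_sum fun w _ => hterm w).trans ?_
  obtain ⟨hz1, hz2, hz3, hr⟩ := hz
  have hrank := mul_finrank_lt_sum_finrank hlm hm z hz1 hz2 hz3 (by simpa using hr)
  rw [Module.finrank_fin_fun] at hrank
  have hsum : ∑ a, Module.finrank F (coeffOrthogonal z a) +
      ∑ a, Module.finrank F (Submodule.span F (z '' {S | a ∉ S})) = l * r := by
    rw [← Finset.sum_add_distrib, Finset.sum_congr rfl fun a _ => finrank_coeffOrthogonal z a]
    simp
  -- The strict rank inequality gives `2 ∑ dim + 1 ≤ l r` in integers; multiplied by `N`, the extra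
  -- 1 becomes the decay `q^(-N)`.
  have hexp : 2 * N * (∑ a, Module.finrank F (coeffOrthogonal z a)) + N ≤ N * l * r := by
    set x := ∑ a, Module.finrank F (coeffOrthogonal z a)
    have h1 : 2 * x + 1 ≤ l * r := by
      subst hlm
      rw [mul_assoc] at hsum ⊢
      omega
    calc 2 * N * x + N = N * (2 * x + 1) := by ring
      _ ≤ N * (l * r) := Nat.mul_le_mul_left _ h1
      _ = N * l * r := by ring
  have hcard : (Fintype.card (compatible N z) : ℝ) ≤
      q ^ (2 * N * ∑ a, Module.finrank F (coeffOrthogonal z a)) := by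
    rw [Fintype.card_eq_nat_card]
    rw [hqdef]
    exact_mod_cast card_compatible_le (N := N) z
  have hq0 : 0 < q := by linarith
  rw [Finset.sum_const, Finset.card_univ, nsmul_eq_mul, mul_div_assoc', div_le_div_iff₀
    (by positivity) (by positivity)]
  calc Fintype.card (compatible N z) * q ^ (r * (r - 1)) * q ^ N
      ≤ q ^ (2 * N * ∑ a, Module.finrank F (coeffOrthogonal z a)) * q ^ (r * (r - 1)) * q ^ N := by
        gcongr
    _ = q ^ (r * (r - 1)) *
        q ^ (2 * N * (∑ a, Module.finrank F (coeffOrthogonal z a)) + N) := by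
        rw [pow_add]; ring
    _ ≤ _ := by
        gcongr
        exact hq.le

end MiddleCocycles

/-! ### The Euler number and its generic value. -/

section Euler

variable {F : Type*} [Field F] {l N : ℕ}

/-- A chain of degree `j` is a family of local vectors indexed by the sets with `j` elements. -/
def chainsEquiv (L : Submodule F (Phase F l N)) (j : ℕ) :
    chains L j ≃ₗ[F] ((S : {S : Finset (Fin l) // S.card = j}) → localPart L S.1) where
  toFun c S := ⟨c.1 S, (c.2 S).1⟩
  map_add' _ _ := rfl
  map_smul' _ _ := rfl
  invFun w := ⟨fun S => if h : S.card = j then (w ⟨S, h⟩).1 else 0, fun S => by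
    by_cases h : S.card = j
    · simp [h]
    · simp [h]⟩
  left_inv c := by
    refine Subtype.ext (funext fun S => ?_)
    by_cases h : S.card = j
    · simp [h]
    · simp [h, (c.2 S).2 h]
  right_inv w := by
    funext S
    simp [S.2]

theorem finrank_chains (L : Submodule F (Phase F l N)) (j : ℕ) :
    Module.finrank F (chains L j) =
      ∑ S : Finset (Fin l), if S.card = j then Module.finrank F (localPart L S) else 0 := by
  rw [(chainsEquiv L j).finrank_eq, Module.finrank_pi_fintype, ← Finset.sum_filter]
  exact (Finset.sum_subtype _ (by simp) fun S => Module.finrank F (localPart L S)).symm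

theorem finrank_homology_add (L : Submodule F (Phase F l N)) (j : ℕ) :
    Module.finrank F (Homology L j) + Module.finrank F (coboundaries L j) =
      Module.finrank F (cocycles L j) := by
  rw [← (Submodule.submoduleOfEquivOfLe (coboundaries_le_cocycles L j)).finrank_eq]
  exact Submodule.finrank_quotient_add_finrank _

theorem finrank_cocycles_add (L : Submodule F (Phase F l N)) (j : ℕ) :
    Module.finrank F (cocycles L j) + Module.finrank F (coboundaries L (j + 1)) =
      Module.finrank F (chains L j) := by
  have h := ((delta F l N).domRestrict (chains L j)).finrank_range_add_finrank_ker
  rw [LinearMap.range_domRestrict, LinearMap.ker_domRestrict] at h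
  have h2 : Module.finrank F (Submodule.comap (chains L j).subtype (LinearMap.ker (delta F l N))) =
      Module.finrank F (cocycles L j) := by
    rw [← Submodule.finrank_map_subtype_eq, Submodule.map_comap_subtype, cocycles]
  rw [h2] at h
  rw [← h, add_comm]
  rfl

/-- Rank-nullity telescopes; the partial sums differ by a coboundary term, which vanishes above
degree `l`. -/
theorem euler_homology_eq (L : Submodule F (Phase F l N)) :
    ∑ j ∈ Finset.range (l + 1), (-1 : ℤ) ^ j * Module.finrank F (Homology L j) =
      ∑ S : Finset (Fin l), (-1 : ℤ) ^ S.card * Module.finrank F (localPart L S) := by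
  have h : ∀ n, ∑ j ∈ Finset.range n, (-1 : ℤ) ^ j * Module.finrank F (Homology L j) =
      ∑ j ∈ Finset.range n, (-1 : ℤ) ^ j * Module.finrank F (chains L j) +
        (-1) ^ n * Module.finrank F (coboundaries L n) := by
    intro n
    induction n with
    | zero => rw [coboundaries, finrank_bot]; simp
    | succ n ih =>
      rw [Finset.sum_range_succ, Finset.sum_range_succ, ih]
      have h1 := finrank_homology_add L n
      have h2 := finrank_cocycles_add L n
      zify at h1 h2
      rw [← h2, ← h1]
      ring
  have h0 : coboundaries L (l + 1) = ⊥ := by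
    rw [eq_bot_iff, ← chains_eq_bot_of_lt L (Nat.lt_succ_self l)]
    exact (coboundaries_le_cocycles L _).trans inf_le_left
  rw [h, h0, finrank_bot, Nat.cast_zero, mul_zero, add_zero]
  simp only [finrank_chains, Nat.cast_sum, Finset.mul_sum]
  rw [Finset.sum_comm]
  refine Finset.sum_congr rfl fun S _ => ?_
  rw [Finset.sum_eq_single S.card]
  · simp
  · intro j _ hj
    rw [if_neg hj.symm]; simp
  · intro h
    have := S.card_le_univ
    rw [Fintype.card_fin] at this
    exact absurd (Finset.mem_range.2 (by omega)) h

theorem cast_choose_succ_mul (n k : ℕ) :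
    (n.choose (k + 1) : ℤ) * (k + 1) = n.choose k * (n - k) := by
  rcases le_or_gt k n with h | h
  · have := Nat.choose_succ_right_eq n k
    zify [h] at this
    exact this
  · rw [Nat.choose_eq_zero_of_lt h, Nat.choose_eq_zero_of_lt (by omega)]; simp

/-- A closed form for every partial sum, since `sum_generic_dim` needs the sum over the upper half
only: the full sum, which is zero, minus the lower half. -/
theorem sum_range_alternating_choose_mul (n J : ℕ) :
    ∑ k ∈ Finset.range (J + 2), ((n + 2).choose k : ℤ) * ((-1) ^ k * (2 * k - (n + 2 : ℕ))) =
      (n + 2) * ((-1) ^ (J + 1) * (n.choose J - n.choose (J + 1))) := by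
  induction J with
  | zero =>
    rw [Finset.sum_range_succ, Finset.sum_range_one]
    simp
    ring
  | succ J ih =>
    rw [Finset.sum_range_succ, ih]
    have h1 := cast_choose_succ_mul n J
    have h2 := cast_choose_succ_mul n (J + 1)
    have h3 : ((n + 2).choose (J + 2) : ℤ) =
        n.choose J + 2 * n.choose (J + 1) + n.choose (J + 2) := by
      rw [Nat.choose_succ_succ (n + 1), Nat.choose_succ_succ n, Nat.choose_succ_succ n]
      push_cast; ring
    rw [show J + 1 + 1 = J + 2 from rfl, h3]
    push_cast at h2 ⊢
    rw [show J + 1 + 1 = J + 2 from rfl] at h2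
    rw [pow_succ (-1 : ℤ) (J + 1)]
    linear_combination ((-1) ^ J * 2) * (h1 + h2)

/-- The alternating sum of the generic dimensions of the spaces of local vectors. -/
theorem sum_generic_dim {m : ℕ} (hlm : l = 2 * m) (hm : 0 < m) :
    (∑ S : Finset (Fin l), if l < 2 * S.card then (-1 : ℤ) ^ S.card * (2 * S.card - l) else 0) =
      (-1) ^ (m + 1) * (2 * (l - 2).choose (m - 1)) := by
  obtain ⟨M, rfl⟩ : ∃ M, m = M + 1 := ⟨m - 1, by omega⟩
  obtain rfl : l = 2 * M + 2 := by omega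
  let f : ℕ → ℤ := fun k => (-1 : ℤ) ^ k * (2 * k - (2 * M + 2 : ℕ))
  have h1 := Finset.sum_powerset_apply_card
    (fun k => if 2 * M + 2 < 2 * k then f k else 0) (x := (Finset.univ : Finset (Fin (2 * M + 2))))
  rw [Finset.powerset_univ, Finset.card_univ, Fintype.card_fin] at h1
  refine h1.trans ?_
  have h2 := sum_range_alternating_choose_mul (2 * M) M
  have h3 := sum_range_alternating_choose_mul (2 * M) (2 * M + 1)
  rw [show 2 * M + 1 + 2 = (M + 2) + (M + 1) by omega, Finset.sum_range_add, h2,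
    Nat.choose_eq_zero_of_lt (by omega : 2 * M < 2 * M + 1),
    Nat.choose_eq_zero_of_lt (by omega : 2 * M < 2 * M + 1 + 1)] at h3
  rw [show 2 * M + 2 + 1 = (M + 2) + (M + 1) by omega, Finset.sum_range_add, Finset.sum_eq_zero,
    zero_add]
  · have h5 : ∀ x ∈ Finset.range (M + 1), ((2 * M + 2).choose (M + 2 + x) •
        (if 2 * M + 2 < 2 * (M + 2 + x) then f (M + 2 + x) else 0) : ℤ) =
        ((2 * M + 2).choose (M + 2 + x) : ℤ) *
          ((-1) ^ (M + 2 + x) * (2 * (M + 2 + x : ℕ) - (2 * M + 2 : ℕ))) := by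
      intro x _
      rw [if_pos (by omega), nsmul_eq_mul]
    rw [Finset.sum_congr rfl h5]
    have h6 := cast_choose_succ_mul (2 * M) M
    simp only [Nat.add_sub_cancel]
    push_cast at h3 h6 ⊢
    linear_combination h3 + 2 * (-1) ^ (M + 1) * h6
  · intro x hx
    rw [if_neg, smul_zero]
    have := Finset.mem_range.1 hx
    omega

/-- For `|S| > l/2` the deviation from the generic dimension is exactly `dim L_{Sᶜ}`, and `Sᶜ` is
small; for the other `S` it is `dim L_S` itself. Hence each small set is counted at most twice. -/
theorem abs_euler_sub_le {m : ℕ} (hlm : l = 2 * m) (hm : 0 < m) (L : LGr F l N) :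
    |(∑ S : Finset (Fin l), (-1 : ℤ) ^ S.card * Module.finrank F (localPart L.1 S)) -
      N * ((-1) ^ (m + 1) * (2 * (l - 2).choose (m - 1)))| ≤
      2 * ∑ S : Finset (Fin l),
        if 2 * S.card ≤ l then (Module.finrank F (localPart L.1 S) : ℤ) else 0 := by
  rw [← sum_generic_dim hlm hm, Finset.mul_sum, ← Finset.sum_sub_distrib]
  set d : Finset (Fin l) → ℤ := fun S => Module.finrank F (localPart L.1 S) with hd
  have hd0 : ∀ S, 0 ≤ d S := fun S => Int.natCast_nonneg _
  have hdual : ∀ S, d S = N * (2 * S.card - l) + d Sᶜ := by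
    intro S
    have := finrank_localPart_add L S
    zify at this
    simp only [hd]
    linear_combination this
  set g : Finset (Fin l) → ℤ := fun S => if 2 * S.card ≤ l then d S else 0 with hg
  have hcompl : ∑ S : Finset (Fin l), g Sᶜ = ∑ S, g S :=
    Equiv.sum_comp (Equiv.ofBijective _ compl_bijective) g
  calc _ ≤ ∑ S : Finset (Fin l), (g S + g Sᶜ) := by
        refine (Finset.abs_sum_le_sum_abs _ _).trans (Finset.sum_le_sum fun S _ => ?_)
        have hc : Sᶜ.card + S.card = l := by
          rw [Finset.card_compl_add_card, Fintype.card_fin]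
        change |(-1) ^ S.card * d S - _| ≤ _
        simp only [hg]
        by_cases h : l < 2 * S.card
        · rw [if_pos h, if_neg (by omega), if_pos (by omega), zero_add]
          have : (-1) ^ S.card * d S - N * ((-1) ^ S.card * (2 * S.card - l)) =
              (-1) ^ S.card * d Sᶜ := by rw [hdual S]; ring
          rw [this, abs_mul, abs_pow, abs_neg, abs_one, one_pow, one_mul, abs_of_nonneg (hd0 _)]
        · rw [if_neg h, if_pos (by omega), mul_zero, sub_zero, abs_mul, abs_pow, abs_neg, abs_one,
            one_pow, one_mul, abs_of_nonneg (hd0 _)]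
          split_ifs
          · linarith [hd0 Sᶜ]
          · linarith
    _ = _ := by rw [Finset.sum_add_distrib, hcompl]; ring

end Euler

/-! ### First-moment bounds and limits. -/

section Asymptotics

variable {F : Type*} [Field F] {l N : ℕ}

theorem nontrivial_of_normDimH_pos {L : LGr F l N} {j : ℕ} (h : 0 < normDimH L j) :
    Nontrivial (Homology L.1 j) := by
  by_contra hn
  rw [not_nontrivial_iff_subsingleton] at hn
  rw [normDimH, Module.finrank_zero_of_subsingleton] at h
  simp at h

/-- Twice the sum of the dimensions of the spaces of vectors local to at most half of the
parties, which bounds the deviation of the Euler number. -/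
noncomputable def smallDim (L : LGr F l N) : ℝ :=
  2 * ∑ S : Finset (Fin l), if 2 * S.card ≤ l then (Module.finrank F (localPart L.1 S) : ℝ) else 0

theorem smallDim_nonneg (L : LGr F l N) : 0 ≤ smallDim L := by
  refine mul_nonneg zero_le_two (Finset.sum_nonneg fun S _ => ?_)
  split_ifs <;> positivity

theorem normDimC_le_smallDim {j : ℕ} (hj : 2 * j ≤ l) (L : LGr F l N) :
    normDimC L j ≤ smallDim L / N := by
  refine div_le_div_of_nonneg_right ?_ (Nat.cast_nonneg N)
  rw [finrank_chains, smallDim, Nat.cast_sum, Finset.mul_sum]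
  refine Finset.sum_le_sum fun S _ => ?_
  by_cases hS : S.card = j
  · rw [if_pos hS, if_pos (by omega)]
    linarith [Nat.cast_nonneg (α := ℝ) (Module.finrank F (localPart L.1 S))]
  · rw [if_neg hS]
    split_ifs <;> simp

theorem abs_normEuler_sub_le {m : ℕ} (hlm : l = 2 * m) (hm : 0 < m) (hN : 0 < N) (L : LGr F l N) :
    |normEuler L - (-1) ^ (m + 1) * (2 * (l - 2).choose (m - 1))| ≤ smallDim L / N := by
  have hN' : (0 : ℝ) < N := by exact_mod_cast hN
  have h := abs_euler_sub_le hlm hm L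
  rw [← euler_homology_eq] at h
  have h' := (Int.cast_le (R := ℝ)).2 h
  push_cast at h'
  have h2 : normEuler L - (-1) ^ (m + 1) * (2 * (l - 2).choose (m - 1)) =
      (∑ j ∈ Finset.range (l + 1), (-1) ^ j * (Module.finrank F (Homology L.1 j) : ℝ) -
        N * ((-1) ^ (m + 1) * (2 * (l - 2).choose (m - 1)))) / N := by
    rw [sub_div, mul_div_cancel_left₀ _ hN'.ne', normEuler, Finset.sum_div]
    congr 1
    exact Finset.sum_congr rfl fun j _ => by rw [normDimH, mul_div_assoc]
  rw [h2, abs_div, abs_of_pos hN']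
  exact div_le_div_of_nonneg_right h' hN'.le

theorem normEuler_eq_of_subsingleton {m : ℕ} (hm : m + 1 ≤ l) (L : LGr F l N)
    (h : ∀ j ∈ (Finset.range (l + 1)).erase (m + 1), ¬ Nontrivial (Homology L.1 j)) :
    normEuler L = (-1) ^ (m + 1) * normDimH L (m + 1) := by
  refine Finset.sum_eq_single (m + 1) (fun j hj hjm => ?_) fun h' =>
    absurd (Finset.mem_range.2 (by omega)) h'
  have h1 : Subsingleton (Homology L.1 j) :=
    not_nontrivial_iff_subsingleton.1 (h j (Finset.mem_erase.2 ⟨hjm, hj⟩))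
  rw [normDimH, Module.finrank_zero_of_subsingleton]
  simp

variable [Finite F]

theorem one_lt_card_real : (1 : ℝ) < Nat.card F := by
  exact_mod_cast Finite.one_lt_card (α := F)

/-- The random variable counts the nonzero vectors of `L` supported on `S`; each of the fewer than
`q^(2N|S|)` candidates is in `L` with probability at most `q^(-Nl)`. -/
theorem expect_card_localPart_le (S : Finset (Fin l)) :
    expect (fun L : LGr F l N =>
        (Nat.card F : ℝ) ^ Module.finrank F (localPart L.1 S) - 1) ≤
      (Nat.card F : ℝ) ^ (2 * N * S.card) / (Nat.card F : ℝ) ^ (N * l) := by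
  classical
  let X := localPart (⊤ : Submodule F (Phase F l N)) S
  have := Fintype.ofFinite X
  have h1 : ∀ L : LGr F l N, (Nat.card F : ℝ) ^ Module.finrank F (localPart L.1 S) - 1 =
      ∑ v : X, if v.1 ∈ L.1 ∧ v ≠ 0 then (1 : ℝ) else 0 := by
    intro L
    have e : {v : X // v.1 ∈ L.1 ∧ v ≠ 0} ≃ {v : localPart L.1 S // v ≠ 0} :=
      { toFun := fun v => ⟨⟨v.1.1, v.2.1, v.1.2.2⟩, fun h => v.2.2
          (Subtype.ext (congrArg (fun w : localPart L.1 S => w.1) h))⟩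
        invFun := fun v => ⟨⟨v.1.1, trivial, v.1.2.2⟩, v.1.2.1, fun h => v.2
          (Subtype.ext (congrArg (fun w : X => w.1) h))⟩
        left_inv := fun _ => rfl
        right_inv := fun _ => rfl }
    have := Fintype.ofFinite (localPart L.1 S)
    have h2 : Fintype.card {v : localPart L.1 S // v ≠ 0} + 1 =
        Nat.card F ^ Module.finrank F (localPart L.1 S) := by
      rw [← Module.natCard_eq_pow_finrank (K := F), Nat.card_eq_fintype_card,
        Fintype.card_subtype_compl, Fintype.card_subtype_eq]
      exact Nat.sub_add_cancel Fintype.card_pos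
    rw [Finset.sum_boole, ← Fintype.card_subtype, Fintype.card_congr e, ← Nat.cast_pow, ← h2]
    push_cast; ring
  simp only [h1]
  rw [expect_sum]
  have h2 : ∀ v : X, expect (fun L : LGr F l N => if v.1 ∈ L.1 ∧ v ≠ 0 then (1 : ℝ) else 0) ≤
      1 / (Nat.card F : ℝ) ^ (N * l) := by
    intro v
    have hp : (expect fun L : LGr F l N => if v.1 ∈ L.1 ∧ v ≠ 0 then (1 : ℝ) else 0) =
        prob fun L : LGr F l N => v.1 ∈ L.1 ∧ v ≠ 0 := by
      rw [prob_eq_expect]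
      congr!
    rw [hp]
    by_cases hv : v = 0
    · simp only [hv, ne_eq, not_true_eq_false, and_false]
      rw [prob]
      simp
    · have h := prob_ge_le (Submodule.span F {v.1})
      rw [finrank_span_singleton fun h => hv (Subtype.ext h)] at h
      refine (prob_mono fun L hL => ?_).trans (h.trans (by simp))
      rw [Submodule.span_singleton_le_iff_mem]
      exact hL.1
  refine (Finset.sum_le_sum fun v _ => h2 v).trans (le_of_eq ?_)
  rw [Finset.sum_const, Finset.card_univ, Fintype.card_eq_nat_card,
    Module.natCard_eq_pow_finrank (K := F), finrank_localPart_top, nsmul_eq_mul]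
  push_cast
  ring

theorem natCast_le_pow_sub_one (d : ℕ) : (d : ℝ) ≤ (Nat.card F : ℝ) ^ d - 1 := by
  have := one_add_mul_sub_le_pow (a := (Nat.card F : ℝ))
    (by linarith [one_lt_card_real (F := F)]) d
  have h2 : (2 : ℝ) ≤ Nat.card F := by
    exact_mod_cast Finite.one_lt_card (α := F)
  nlinarith [Nat.cast_nonneg (α := ℝ) d]

theorem expect_finrank_localPart_le (S : Finset (Fin l)) :
    expect (fun L : LGr F l N => (Module.finrank F (localPart L.1 S) : ℝ)) ≤
      (Nat.card F : ℝ) ^ (2 * N * S.card) / (Nat.card F : ℝ) ^ (N * l) :=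
  (expect_mono fun _ => natCast_le_pow_sub_one _).trans (expect_card_localPart_le S)

theorem expect_finrank_localPart_le_one (S : Finset (Fin l)) (hS : 2 * S.card ≤ l) :
    expect (fun L : LGr F l N => (Module.finrank F (localPart L.1 S) : ℝ)) ≤ 1 := by
  refine (expect_finrank_localPart_le S).trans (div_le_one_of_le₀ ?_ (by positivity))
  refine pow_le_pow_right₀ one_lt_card_real.le ?_
  calc 2 * N * S.card = N * (2 * S.card) := by ring
    _ ≤ N * l := Nat.mul_le_mul_left _ hS

theorem expect_finrank_localPart_le_inv (S : Finset (Fin l)) (hS : 2 * S.card < l) :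
    expect (fun L : LGr F l N => (Module.finrank F (localPart L.1 S) : ℝ)) ≤
      1 / (Nat.card F : ℝ) ^ N := by
  have hq := one_lt_card_real (F := F)
  refine (expect_finrank_localPart_le S).trans ?_
  rw [div_le_div_iff₀ (by positivity) (by positivity), one_mul, ← pow_add]
  refine pow_le_pow_right₀ hq.le ?_
  calc 2 * N * S.card + N = N * (2 * S.card + 1) := by ring
    _ ≤ N * l := Nat.mul_le_mul_left _ hS

theorem prob_chains_le {j : ℕ} (hj : 2 * j < l) :
    prob (fun L : LGr F l N => chains L.1 j ≠ ⊥) ≤ 2 ^ l / (Nat.card F : ℝ) ^ N := by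
  have h1 : ∀ L : LGr F l N, chains L.1 j ≠ ⊥ → 1 ≤ ∑ S : Finset (Fin l),
      if S.card = j then (Module.finrank F (localPart L.1 S) : ℝ) else 0 := by
    intro L hL
    have h2 : 0 < Module.finrank F (chains L.1 j) :=
      Nat.pos_of_ne_zero fun h => hL (Submodule.finrank_eq_zero.1 h)
    rw [finrank_chains] at h2
    exact_mod_cast h2
  refine (prob_le_expect (fun L => Finset.sum_nonneg fun S _ => ?_) h1).trans ?_
  · split_ifs <;> positivity
  rw [expect_sum]
  have h3 : ∀ S : Finset (Fin l), expect (fun L : LGr F l N =>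
      if S.card = j then (Module.finrank F (localPart L.1 S) : ℝ) else 0) ≤
        1 / (Nat.card F : ℝ) ^ N := by
    intro S
    split_ifs with hS
    · exact expect_finrank_localPart_le_inv S (by omega)
    · rw [expect_const]; positivity
  refine (Finset.sum_le_sum fun S _ => h3 S).trans (le_of_eq ?_)
  rw [Finset.sum_const, Finset.card_univ, Fintype.card_finset, Fintype.card_fin, nsmul_eq_mul]
  push_cast
  ring

theorem prob_cocycles_le_of_le {j : ℕ} (hl : 0 < l) (hj : 2 * j ≤ l) :
    ∃ C : ℝ, ∀ N : ℕ, prob (fun L : LGr F l N => cocycles L.1 j ≠ ⊥) ≤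
      C / (Nat.card F : ℝ) ^ N := by
  rcases hj.lt_or_eq with h | h
  · refine ⟨2 ^ l, fun N => (prob_mono fun L hL hc => hL ?_).trans (prob_chains_le h)⟩
    rw [eq_bot_iff, ← hc]
    exact inf_le_left
  · exact prob_cocycles_le h.symm (by omega)

/-- The upper range is dual to the lower one: `2j ≥ l + 4` means `2(l + 2 - j) ≤ l`. Degrees above
`l` have no chains and are treated apart. -/
theorem prob_homology_le (hl : 2 ≤ l) {j : ℕ} (hj : 2 * j ≤ l ∨ l + 4 ≤ 2 * j) :
    ∃ C : ℝ, ∀ N : ℕ, prob (fun L : LGr F l N => Nontrivial (Homology L.1 j)) ≤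
      C / (Nat.card F : ℝ) ^ N := by
  rcases hj with hj | hj
  · obtain ⟨C, hC⟩ := prob_cocycles_le_of_le (F := F) (by omega) hj
    refine ⟨C, fun N => (prob_mono fun L hL hc => ?_).trans (hC N)⟩
    have : Subsingleton (Homology L.1 j) := subsingleton_homology (hc.le.trans bot_le)
    exact not_subsingleton_iff_nontrivial.2 hL this
  · rcases le_or_gt j l with hjl | hjl
    · obtain ⟨C, hC⟩ := prob_cocycles_le_of_le (F := F) (l := l) (j := l + 2 - j) (by omega)
        (by omega)
      refine ⟨C, fun N => (prob_mono fun L hL hc => ?_).trans (hC N)⟩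
      have := subsingleton_homology_of_dual hl L (show j + (l + 2 - j) = l + 2 by omega)
        (by omega) hc
      exact not_subsingleton_iff_nontrivial.2 hL this
    · refine ⟨0, fun N => ?_⟩
      have h : ∀ L : LGr F l N, ¬ Nontrivial (Homology L.1 j) := fun L hL => by
        have : Subsingleton (Homology L.1 j) := subsingleton_homology
          (inf_le_left.trans ((chains_eq_bot_of_lt L.1 hjl).le.trans bot_le))
        exact not_subsingleton_iff_nontrivial.2 hL this
      simp only [h, prob]
      simp

theorem tendsto_div_card_pow (C : ℝ) :
    Tendsto (fun N : ℕ => C / (Nat.card F : ℝ) ^ N) atTop (𝓝 0) :=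
  tendsto_const_nhds.div_atTop (tendsto_pow_atTop_atTop_of_one_lt one_lt_card_real)

theorem tendsto_prob_homology (hl : 2 ≤ l) {j : ℕ} (hj : 2 * j ≤ l ∨ l + 4 ≤ 2 * j) :
    Tendsto (fun N : ℕ => prob fun L : LGr F l N => Nontrivial (Homology L.1 j)) atTop (𝓝 0) := by
  obtain ⟨C, hC⟩ := prob_homology_le (F := F) hl hj
  exact squeeze_zero (fun N => prob_nonneg _) hC (tendsto_div_card_pow C)

theorem expect_smallDim_le : expect (smallDim (F := F) (l := l) (N := N)) ≤ 2 * 2 ^ l := by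
  have h : expect (smallDim (F := F) (l := l) (N := N)) = _ := expect_mul_left 2 _
  rw [h, expect_sum]
  refine mul_le_mul_of_nonneg_left ?_ zero_le_two
  have h3 : ∀ S : Finset (Fin l), expect (fun L : LGr F l N =>
      if 2 * S.card ≤ l then (Module.finrank F (localPart L.1 S) : ℝ) else 0) ≤ 1 := by
    intro S
    split_ifs with hS
    · exact expect_finrank_localPart_le_one S hS
    · rw [expect_const]; norm_num
  refine (Finset.sum_le_sum fun S _ => h3 S).trans (le_of_eq ?_)
  rw [Finset.sum_const, Finset.card_univ, Fintype.card_finset, Fintype.card_fin, nsmul_eq_mul]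
  simp

theorem prob_le_of_smallDim {ε : ℝ} (hε : 0 < ε) :
    prob (fun L : LGr F l N => ε ≤ smallDim L / N) ≤ 2 * 2 ^ l / ε / N := by
  rcases Nat.eq_zero_or_pos N with rfl | hN
  -- For `N = 0` division by zero makes both the normalised quantity and the bound 0, and the event
  -- is empty.
  · have : (fun L : LGr F l 0 => ε ≤ smallDim L / (0 : ℕ)) = fun _ => False := by
      funext L; simp [hε]
    rw [this, prob]; simp
  have hN' : (0 : ℝ) < N := by exact_mod_cast hN
  have h := prob_le_expect (E := fun L : LGr F l N => ε ≤ smallDim L / N)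
    (X := fun L => (1 / ε / N) * smallDim L)
    (fun L => mul_nonneg (by positivity) (smallDim_nonneg L)) (fun L hL => by
      rw [le_div_iff₀ hN'] at hL
      rw [div_div, one_div_mul_eq_div, le_div_iff₀ (by positivity)]
      linarith)
  refine h.trans ?_
  rw [expect_mul_left]
  calc _ ≤ (1 / ε / N) * (2 * 2 ^ l) :=
        mul_le_mul_of_nonneg_left expect_smallDim_le (by positivity)
    _ = _ := by ring

theorem tendsto_prob_smallDim {ε : ℝ} (hε : 0 < ε) :
    Tendsto (fun N : ℕ => prob fun L : LGr F l N => ε ≤ smallDim L / N) atTop (𝓝 0) :=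
  squeeze_zero (fun _ => prob_nonneg _) (fun _ => prob_le_of_smallDim hε)
    (tendsto_const_div_atTop_nhds_zero_nat _)

theorem tendsto_prob_middle {m : ℕ} (hlm : l = 2 * m) (hm : 0 < m) {ε : ℝ} (hε : 0 < ε) :
    Tendsto (fun N : ℕ => prob fun L : LGr F l N =>
      ε ≤ |normDimH L (m + 1) - 2 * ((l - 2).choose (m - 1) : ℝ)|) atTop (𝓝 0) := by
  have hlim : Tendsto (fun N : ℕ => (prob fun L : LGr F l N => ε ≤ smallDim L / N) +
      ∑ j ∈ (Finset.range (l + 1)).erase (m + 1),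
        prob fun L : LGr F l N => Nontrivial (Homology L.1 j)) atTop (𝓝 0) := by
    have h2 := tendsto_finsetSum ((Finset.range (l + 1)).erase (m + 1)) fun j hj =>
      tendsto_prob_homology (F := F) (l := l) (j := j) (by omega) (by
        have := (Finset.mem_erase.1 hj).1
        omega)
    simpa using (tendsto_prob_smallDim (F := F) (l := l) hε).add h2
  refine squeeze_zero' (Eventually.of_forall fun N => prob_nonneg _) ?_ hlim
  filter_upwards [eventually_gt_atTop 0] with N hN
  -- Union bound: the index `none` stands for a large Euler deviation, `some j` for nonzero homology
  -- in another degree. Outside these events the Euler number is `±` the middle term, within `ε` of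
  -- `±χ`.
  refine (prob_le_sum (Finset.insertNone ((Finset.range (l + 1)).erase (m + 1)))
    (fun i L => i.elim (ε ≤ smallDim L / N) fun j => Nontrivial (Homology L.1 j)) ?_).trans
    (le_of_eq (Finset.sum_insertNone _ _))
  intro L hL
  by_contra! h
  have h1 := h none (by simp)
  have h2 := normEuler_eq_of_subsingleton (m := m) (by omega) L
    fun j hj => h (some j) (by simpa using hj)
  have h3 := abs_normEuler_sub_le hlm hm hN L
  rw [h2, ← mul_sub, abs_mul, abs_pow, abs_neg, abs_one, one_pow, one_mul] at h3
  exact h1 (hL.trans h3)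

theorem tendsto_abs_expect_normEuler {m : ℕ} (hlm : l = 2 * m) (hm : 0 < m) :
    Tendsto (fun N : ℕ => |expect fun L : LGr F l N => normEuler L|) atTop
      (𝓝 (2 * ((l - 2).choose (m - 1) : ℝ))) := by
  set χ : ℝ := 2 * ((l - 2).choose (m - 1) : ℝ) with hχ
  have h : Tendsto (fun N : ℕ => expect fun L : LGr F l N => normEuler L) atTop
      (𝓝 ((-1) ^ (m + 1) * χ)) := by
    rw [tendsto_iff_dist_tendsto_zero]
    refine squeeze_zero' (Eventually.of_forall fun N => dist_nonneg) ?_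
      (tendsto_const_div_atTop_nhds_zero_nat (2 * 2 ^ l : ℝ))
    filter_upwards [eventually_gt_atTop 0] with N hN
    rw [Real.dist_eq]
    refine (abs_expect_sub_le fun L => abs_normEuler_sub_le hlm hm hN L).trans ?_
    have : (fun L : LGr F l N => smallDim L / N) = fun L => (1 / (N : ℝ)) * smallDim L := by
      funext L; ring
    rw [this, expect_mul_left, one_div_mul_eq_div]
    exact div_le_div_of_nonneg_right expect_smallDim_le (Nat.cast_nonneg N)
  have h2 := h.abs
  rwa [abs_mul, abs_pow, abs_neg, abs_one, one_pow, one_mul, abs_of_nonneg (by positivity)] at h2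

end Asymptotics

end StabHom

/-! ### The main theorem. -/

theorem theorem2 (F : Type*) [Field F] [Finite F] (l : ℕ) (hl : 2 ≤ l) :
    (∀ j : ℕ, 2 * j < l →
      Tendsto (fun N : ℕ => StabHom.prob fun L : StabHom.LGr F l N =>
        StabHom.chains L.1 j ≠ ⊥) atTop (𝓝 0)) ∧
    (∀ j : ℕ, (2 * j < l ∨ l + 4 < 2 * j ∨ (Even l ∧ l + 2 < 2 * j)) →
      Tendsto (fun N : ℕ => StabHom.prob fun L : StabHom.LGr F l N =>
        Nontrivial (StabHom.Homology L.1 j)) atTop (𝓝 0)) ∧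
    (Even l →
      (∀ ε : ℝ, 0 < ε →
        Tendsto (fun N : ℕ => StabHom.prob fun L : StabHom.LGr F l N =>
          ε ≤ StabHom.normDimC L (l / 2)) atTop (𝓝 0) ∧
        Tendsto (fun N : ℕ => StabHom.prob fun L : StabHom.LGr F l N =>
          ε ≤ StabHom.normDimH L (l / 2) + StabHom.normDimH L (l / 2 + 2)) atTop (𝓝 0) ∧
        (∀ j : ℕ, j ≠ l / 2 + 1 →
          Tendsto (fun N : ℕ => StabHom.prob fun L : StabHom.LGr F l N =>
            ε ≤ StabHom.normDimH L j) atTop (𝓝 0)) ∧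
        Tendsto (fun N : ℕ => StabHom.prob fun L : StabHom.LGr F l N =>
          ε ≤ |StabHom.normDimH L (l / 2 + 1) - 2 * ((l - 2).choose (l / 2 - 1) : ℝ)|)
          atTop (𝓝 0)) ∧
      Tendsto (fun N : ℕ => |StabHom.expect fun L : StabHom.LGr F l N =>
        StabHom.normEuler L|) atTop (𝓝 (2 * ((l - 2).choose (l / 2 - 1) : ℝ)))) := by
  refine ⟨fun j hj => ?_, fun j hj => ?_, fun heven => ?_⟩
  · exact squeeze_zero (fun N => StabHom.prob_nonneg _) (fun N => StabHom.prob_chains_le hj)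
      (StabHom.tendsto_div_card_pow _)
  · refine StabHom.tendsto_prob_homology hl ?_
    rcases hj with h | h | ⟨⟨m, hm⟩, h⟩ <;> omega
  have hlm : l = 2 * (l / 2) := by
    obtain ⟨m, hm⟩ := heven
    omega
  -- For even `l` the ranges `2j ≤ l` and `2j ≥ l + 4` omit only `j = l/2 + 1`. A positive
  -- normalised dimension forces nonzero homology, so this yields statement 4 and the first half of
  -- 5.
  have hH : ∀ j, j ≠ l / 2 + 1 → Tendsto (fun N : ℕ => StabHom.prob fun L : StabHom.LGr F l N =>
      Nontrivial (StabHom.Homology L.1 j)) atTop (𝓝 0) := fun j hj =>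
    StabHom.tendsto_prob_homology hl (by omega)
  refine ⟨fun ε hε => ⟨?_, ?_, fun j hj => ?_, ?_⟩, ?_⟩
  · exact squeeze_zero (fun N => StabHom.prob_nonneg _)
      (fun N => StabHom.prob_mono fun L hL =>
        hL.trans (StabHom.normDimC_le_smallDim hlm.ge L))
      (StabHom.tendsto_prob_smallDim hε)
  · have h := tendsto_finsetSum {l / 2, l / 2 + 2} fun j hj => hH j (by
      simp only [Finset.mem_insert, Finset.mem_singleton] at hj
      omega)
    rw [Finset.sum_const_zero] at h
    refine squeeze_zero (fun N => StabHom.prob_nonneg _)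
      (fun N => StabHom.prob_le_sum {l / 2, l / 2 + 2} _ fun L hL => ?_) h
    rcases lt_or_ge 0 (StabHom.normDimH L (l / 2)) with h1 | h1
    · exact ⟨_, by simp, StabHom.nontrivial_of_normDimH_pos h1⟩
    · exact ⟨l / 2 + 2, by simp, StabHom.nontrivial_of_normDimH_pos (by linarith)⟩
  · exact squeeze_zero (fun N => StabHom.prob_nonneg _)
      (fun N => StabHom.prob_mono fun L hL =>
        StabHom.nontrivial_of_normDimH_pos (hε.trans_le hL)) (hH j hj)
  · exact StabHom.tendsto_prob_middle hlm (by omega) hε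
  · exact StabHom.tendsto_abs_expect_normEuler hlm (by omega)
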